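/- **Theorem 3.1.** Let $d\in\mathbb N$, $\kappa>0$, $\beta\in\mathbb R$, and let $\Pi:[0,\infty)\to(0,\infty)$ be non-decreasing, doubling ($\Pi(2p)\le C\,\Pi(p)$ for all $p\ge 0$), with $\sum_{j=N}^{\infty}2^{-j\kappa}\Pi(j)\le C\,2^{-N\kappa}\Pi(N)$ for every integer $N\ge 0$, for some constant $C$. Let $\dot{\mathcal S}(\mathbb R^d)$ be the space of Schwartz functions $\psi$ with $(D^\gamma\widehat\psi)(0)=0$ for all multi-indices $\gamma$, and $\dot{\mathcal S}'(\mathbb R^d)$ its dual (tempered distributions modulo polynomials). Fix a radial function $\varphi\in C_c^\infty(\mathbb R^d)$ with $\operatorname{supp}\varphi\subset\{\tfrac34<|\xi|<\tfrac74\}$, $\varphi=1$ for $\tfrac78<|\xi|<\tfrac98$ and $\sum_{j\in\mathbb Z}\varphi(2^{-j}\xi)=1$ for $\xi\ne0$, and put $\widehat{\dot\Delta_jf}=\varphi(2^{-j}\cdot)\widehat f$. For $f\in\dot{\mathcal S}'(\mathbb R^d)$ and $s\in\mathbb R$ let $$\|f\|_{\dot B^{s}_{\infty,1}}=\sum_{j\in\mathbb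 Z}2^{js}\|\dot\Delta_jf\|_{L^\infty(\mathbb R^d)},\qquad \|f\|_{\dot B^{\beta}_{\Pi}}=\sup_{N\in\{0,1,2,\dots\}}\frac1{\Pi(N)}\sum_{j=-\infty}^{N}2^{j\beta}\|\dot\Delta_jf\|_{L^\infty(\mathbb R^d)},$$ both with values in $[0,\infty]$; $\dot B^{s}_{\infty,1}$ consists of the $f$ with $\|f\|_{\dot B^s_{\infty,1}}<\infty$. Let $A_0=\dot B^{\beta-\kappa}_{\infty,1}$, $A_1=\dot B^{\beta}_{\infty,1}$, $$K(t,f;A_0,A_1)=\inf\{\|f_0\|_{A_0}+t\|f_1\|_{A_1}: f=f_0+f_1,\ f_i\in A_i\}\qquad(\inf\emptyset=\infty),$$ $y_\Pi(r)=\inf_{p>1}\Pi(p)\,r^{1/p}$ for $r>0$, and, for $\theta\in(0,1)$ and $p\in[1,\infty)$, $$\|f\|_{(A_0,A_1)^{\blacktriangleleft}_{\theta,p}}=(\theta(1-\theta)p)^{1/p}\Big(\int_0^\infty\big(t^{-\theta}K(t,f;A_0,A_1)\big)^p\,\frac{dt}{t}\Big)^{1/p}.$$ Then, for all $f\in\dot{\mathcal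 S}'(\mathbb R^d)$, $$\max\Big\{\|f\|_{\dot B^{\beta}_{\Pi}},\|f\|_{\dot B^{\beta-\kappa}_{\infty,1}}\Big\}\approx\sup_{t\in(0,\infty)}\frac{K(t,f;A_0,A_1)}{t\,y_\Pi(1/t)}\approx\sup_{\theta\in(0,1)}\frac{\|f\|_{(A_0,A_1)^{\blacktriangleleft}_{\theta,\frac1{1-\theta}}}}{\Pi\big(\frac1{1-\theta}\big)}\approx\sup_{\alpha\in(\beta-\kappa,\beta)}\frac{\|f\|_{\dot B^{\alpha}_{\infty,1}}}{\Pi\big(\frac1{\beta-\alpha}\big)}.$$ Here $A\approx B$ means $A\le C'B$ and $B\le C'A$ in $[0,\infty]$ with a constant $C'$ independent of $f$; in particular, if one of the four quantities is finite, so are the other three. -/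

import Mathlib

open scoped SchwartzMap FourierTransform ENNReal NNReal ContDiff

noncomputable section

namespace Vishik

/-! ### Growth functions and Yudovich functions -/

/-- The class of growth functions attached to `κ`. Only the values of `P` on `[0, ∞)` matter.
The hypotheses are: positivity, monotonicity, the doubling property, and
`∑_{j ≥ N} 2^{-jκ} P(j) ≲ 2^{-Nκ} P(N)` (a convergent series) for all integers `N ≥ 0`. -/
structure GrowthClass (κ : ℝ) (P : ℝ → ℝ) : Prop where
  pos : ∀ p, 0 ≤ p → 0 < P p
  mono : MonotoneOn P (Set.Ici 0)
  doubling : ∃ C : ℝ, ∀ p, 0 ≤ p → P (2 * p) ≤ C * P p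
  tail : ∃ C : ℝ, ∀ N : ℕ,
    Summable (fun i : ℕ => (2 : ℝ) ^ (-((N + i : ℕ) : ℝ) * κ) * P ((N + i : ℕ) : ℝ)) ∧
    ∑' i : ℕ, (2 : ℝ) ^ (-((N + i : ℕ) : ℝ) * κ) * P ((N + i : ℕ) : ℝ)
      ≤ C * ((2 : ℝ) ^ (-(N : ℝ) * κ) * P N)

/-- The Yudovich function `y_P(r) = inf_{p > 1} P(p) r^{1/p}`, for `r > 0`. -/
def yudovich (P : ℝ → ℝ) (r : ℝ) : ℝ :=
  ⨅ p : Set.Ioi (1 : ℝ), P p * r ^ (1 / (p : ℝ))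

/-! ### Real interpolation and `Δ`-extrapolation

A pair of compatible spaces inside a vector space `V` is given by two `[0, ∞]`-valued norms on `V`;
the space `A_i` is `{f | N_i f < ∞}`. -/

/-- The Peetre `K`-functional. It is `∞` when `f ∉ A₀ + A₁`. -/
def kFunctional {V : Type*} [AddCommGroup V] (N₀ N₁ : V → ℝ≥0∞) (t : ℝ) (f : V) : ℝ≥0∞ :=
  ⨅ (f₀ : V) (f₁ : V) (_ : f = f₀ + f₁) (_ : N₀ f₀ < ⊤) (_ : N₁ f₁ < ⊤),
    N₀ f₀ + ENNReal.ofReal t * N₁ f₁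

/-- The norm of the real interpolation space `(A₀, A₁)_{θ,p}`, for `1 ≤ p < ∞`. -/
def interpNorm {V : Type*} [AddCommGroup V] (N₀ N₁ : V → ℝ≥0∞) (θ p : ℝ) (f : V) : ℝ≥0∞ :=
  (∫⁻ t in Set.Ioi (0 : ℝ),
    (ENNReal.ofReal (t ^ (-θ)) * kFunctional N₀ N₁ t f) ^ p * ENNReal.ofReal t⁻¹) ^ (1 / p)

/-- The normalized interpolation norm, i.e. the norm above times `(θ (1 - θ) p)^{1/p}`. -/
def normalizedInterpNorm {V : Type*} [AddCommGroup V] (N₀ N₁ : V → ℝ≥0∞) (θ p : ℝ) (f : V) :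
    ℝ≥0∞ :=
  ENNReal.ofReal ((θ * (1 - θ) * p) ^ (1 / p)) * interpNorm N₀ N₁ θ p f

/-- The norm of the `Δ`-extrapolation space of the family of normalized spaces
`(A₀, A₁)_{θ,p(θ)}`, `0 < θ < 1`, with weights `P(1/(1-θ))`. -/
def deltaNorm {V : Type*} [AddCommGroup V] (N₀ N₁ : V → ℝ≥0∞) (p : ℝ → ℝ) (P : ℝ → ℝ) (f : V) :
    ℝ≥0∞ :=
  ⨆ θ ∈ Set.Ioo (0 : ℝ) 1,
    normalizedInterpNorm N₀ N₁ θ (p θ) f / ENNReal.ofReal (P (1 / (1 - θ)))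

/-- Two `[0, ∞]`-valued quantities are equivalent if each is bounded by a constant times the
other, the constant being the same for all `f`. -/
def Equivalent {V : Type*} (A B : V → ℝ≥0∞) : Prop :=
  ∃ C : ℝ≥0, ∀ f, A f ≤ C * B f ∧ B f ≤ C * A f

/-! ### Homogeneous distributions and Littlewood–Paley blocks -/

/-- Schwartz functions on `ℝ^d` all of whose derivatives of the Fourier transform vanish at `0`,
with the topology inherited from the Schwartz space. -/
def dotSchwartz (d : ℕ) : Submodule ℂ 𝓢(EuclideanSpace ℝ (Fin d), ℂ) where
  carrier := {ψ | ∀ n : ℕ,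
    iteratedFDeriv ℝ n (𝓕 ψ : 𝓢(EuclideanSpace ℝ (Fin d), ℂ)) 0 = 0}
  zero_mem' := by
    intro n
    rw [FourierTransform.fourier_zero]
    have : ((0 : 𝓢(EuclideanSpace ℝ (Fin d), ℂ)) : EuclideanSpace ℝ (Fin d) → ℂ) = 0 := rfl
    rw [this, iteratedFDeriv_zero]
    rfl
  add_mem' := by
    intro a b ha hb n
    rw [FourierTransform.fourier_add]
    have : ((𝓕 a + 𝓕 b : 𝓢(EuclideanSpace ℝ (Fin d), ℂ)) : EuclideanSpace ℝ (Fin d) → ℂ)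
      = (𝓕 a : 𝓢(EuclideanSpace ℝ (Fin d), ℂ)) + (𝓕 b : 𝓢(EuclideanSpace ℝ (Fin d), ℂ)) := rfl
    rw [this, iteratedFDeriv_add_apply (((𝓕 a).smooth n).contDiffAt)
      (((𝓕 b).smooth n).contDiffAt), ha n, hb n, add_zero]
  smul_mem' := by
    intro c a ha n
    rw [FourierTransform.fourier_smul]
    have : ((c • 𝓕 a : 𝓢(EuclideanSpace ℝ (Fin d), ℂ)) : EuclideanSpace ℝ (Fin d) → ℂ)
      = c • ((𝓕 a : 𝓢(EuclideanSpace ℝ (Fin d), ℂ)) : EuclideanSpace ℝ (Fin d) → ℂ) := rfl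
    rw [this, iteratedFDeriv_const_smul_apply (((𝓕 a).smooth n).contDiffAt), ha n, smul_zero]

/-- The dual of `dotSchwartz d` (tempered distributions modulo polynomials). -/
abbrev DotDistribution (d : ℕ) : Type := dotSchwartz d →L[ℂ] ℂ

/-- A generator of a dyadic resolution of unity on `ℝ^d`: a radial smooth function supported in
the annulus `3/4 < |ξ| < 7/4` (hence compactly supported), equal to `1` for `7/8 < |ξ| < 9/8`,
with `∑_{j ∈ ℤ} φ(2^{-j} ξ) = 1` for `ξ ≠ 0`. -/
structure Generator (d : ℕ) where
  toFun : EuclideanSpace ℝ (Fin d) → ℝ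
  smooth : ContDiff ℝ ∞ toFun
  radial : ∀ ξ η, ‖ξ‖ = ‖η‖ → toFun ξ = toFun η
  tsupport_subset : tsupport toFun ⊆ {ξ | 3 / 4 < ‖ξ‖ ∧ ‖ξ‖ < 7 / 4}
  eq_one : ∀ ξ, 7 / 8 < ‖ξ‖ → ‖ξ‖ < 9 / 8 → toFun ξ = 1
  hasSum_one : ∀ ξ, ξ ≠ 0 → HasSum (fun j : ℤ => toFun ((2 : ℝ) ^ (-j) • ξ)) 1

variable {d : ℕ}

/-- The dilate `ξ ↦ φ(2^{-j} ξ)`, as a complex-valued function. -/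
def Generator.symbol (φ : Generator d) (j : ℤ) (ξ : EuclideanSpace ℝ (Fin d)) : ℂ :=
  (φ.toFun ((2 : ℝ) ^ (-j) • ξ) : ℂ)

theorem Generator.hasTemperateGrowth_symbol (φ : Generator d) (j : ℤ) :
    (φ.symbol j).HasTemperateGrowth := by
  have hne : ((2 : ℝ) ^ (-j)) ≠ 0 := by positivity
  have hc : HasCompactSupport φ.toFun := by
    refine HasCompactSupport.of_support_subset_isCompact
      (isCompact_closedBall (0 : EuclideanSpace ℝ (Fin d)) (7 / 4)) ?_
    intro ξ hξ
    have := φ.tsupport_subset (subset_tsupport _ hξ)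
    simpa using this.2.le
  have h1 : HasCompactSupport (fun ξ => φ.toFun ((2 : ℝ) ^ (-j) • ξ)) := hc.comp_smul hne
  have h2 : HasCompactSupport (φ.symbol j) := h1.comp_left (g := ((↑) : ℝ → ℂ)) rfl
  have h3 : ContDiff ℝ ∞ (φ.symbol j) := by
    have := φ.smooth
    unfold Generator.symbol
    exact Complex.ofRealCLM.contDiff.comp (this.comp (contDiff_const_smul _))
  exact (h2.toSchwartzMap h3).hasTemperateGrowth

/-- The operator `ψ ↦ 𝓕 (φ(2^{-j} ·) 𝓕⁻¹ ψ)` on Schwartz functions, the transpose of the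
frequency localization `u ↦ 𝓕⁻¹ (φ(2^{-j} ·) 𝓕 u)`. -/
def Generator.transposeAux (φ : Generator d) (j : ℤ) :
    𝓢(EuclideanSpace ℝ (Fin d), ℂ) →L[ℂ] 𝓢(EuclideanSpace ℝ (Fin d), ℂ) :=
  FourierTransform.fourierCLM ℂ 𝓢(EuclideanSpace ℝ (Fin d), ℂ) ∘L
    (SchwartzMap.smulLeftCLM ℂ (φ.symbol j)) ∘L
    FourierTransform.fourierInvCLM ℂ 𝓢(EuclideanSpace ℝ (Fin d), ℂ)

theorem Generator.transposeAux_apply (φ : Generator d) (j : ℤ)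
    (ψ : 𝓢(EuclideanSpace ℝ (Fin d), ℂ)) :
    φ.transposeAux j ψ = 𝓕 (SchwartzMap.smulLeftCLM ℂ (φ.symbol j) (𝓕⁻ ψ)) := rfl

theorem Generator.transposeAux_mem (φ : Generator d) (j : ℤ)
    (ψ : 𝓢(EuclideanSpace ℝ (Fin d), ℂ)) : φ.transposeAux j ψ ∈ dotSchwartz d := by
  intro n
  rw [Generator.transposeAux_apply]
  set h := SchwartzMap.smulLeftCLM ℂ (φ.symbol j) (𝓕⁻ ψ) with hh
  have key : ∀ x, (𝓕 (𝓕 h) : 𝓢(EuclideanSpace ℝ (Fin d), ℂ)) x = h (-x) := by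
    intro x
    have e1 : (𝓕⁻ (𝓕 h) : 𝓢(EuclideanSpace ℝ (Fin d), ℂ)) (-x) = h (-x) := by
      rw [FourierTransform.fourierInv_fourier_eq]
    rw [← e1, SchwartzMap.fourierInv_coe, SchwartzMap.fourier_coe,
      Real.fourierInv_eq_fourier_neg, neg_neg]
  have hpos : (0 : ℝ) < (2 : ℝ) ^ (-j) := by positivity
  have hz : ((𝓕 (𝓕 h) : 𝓢(EuclideanSpace ℝ (Fin d), ℂ)) : EuclideanSpace ℝ (Fin d) → ℂ)
      =ᶠ[nhds 0] 0 := by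
    have hcont : Continuous (fun x : EuclideanSpace ℝ (Fin d) => ‖(2 : ℝ) ^ (-j) • (-x)‖) := by
      fun_prop
    have hlt : ∀ᶠ x in nhds (0 : EuclideanSpace ℝ (Fin d)),
        ‖(2 : ℝ) ^ (-j) • (-x)‖ < 3 / 4 :=
      hcont.continuousAt.eventually (gt_mem_nhds (by norm_num))
    filter_upwards [hlt] with x hx
    have h0 : φ.toFun ((2 : ℝ) ^ (-j) • (-x)) = 0 := by
      by_contra hne
      have := (φ.tsupport_subset (subset_tsupport _ hne)).1
      linarith
    rw [key, hh, SchwartzMap.smulLeftCLM_apply_apply (φ.hasTemperateGrowth_symbol j)]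
    simp only [Generator.symbol, h0]
    simp
  rw [(hz.iteratedFDeriv ℝ n).eq_of_nhds, iteratedFDeriv_zero]
  rfl

/-- The frequency localization `ψ ↦ 𝓕 (φ(2^{-j} ·) 𝓕⁻¹ ψ)` as a map into `dotSchwartz d`. -/
def Generator.transpose (φ : Generator d) (j : ℤ) :
    𝓢(EuclideanSpace ℝ (Fin d), ℂ) →L[ℂ] dotSchwartz d :=
  (φ.transposeAux j).codRestrict (dotSchwartz d) (φ.transposeAux_mem j)

/-- The Littlewood–Paley block `Δ̇_j f = 𝓕⁻¹ (φ(2^{-j} ·) 𝓕 f)`, a tempered distribution. -/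
def Generator.block (φ : Generator d) (j : ℤ) (f : DotDistribution d) :
    𝓢'(EuclideanSpace ℝ (Fin d), ℂ) :=
  ContinuousLinearMap.toPointwiseConvergenceCLM ℂ (RingHom.id ℂ) _ _ (f ∘L φ.transpose j)

theorem Generator.block_apply (φ : Generator d) (j : ℤ) (f : DotDistribution d)
    (ψ : 𝓢(EuclideanSpace ℝ (Fin d), ℂ)) : φ.block j f ψ = f (φ.transpose j ψ) := rfl

/-- The `L^∞(ℝ^d)` norm of a tempered distribution: the norm of the (unique) `L^∞` function
representing it, and `∞` if there is none. -/
def supNorm (u : 𝓢'(EuclideanSpace ℝ (Fin d), ℂ)) : ℝ≥0∞ :=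
  ⨅ (g : MeasureTheory.Lp ℂ ∞ (MeasureTheory.volume : MeasureTheory.Measure
      (EuclideanSpace ℝ (Fin d))))
    (_ : MeasureTheory.Lp.toTemperedDistribution g = u), ‖g‖ₑ

/-! ### Besov and Vishik norms -/

/-- The norm of the homogeneous Besov space `Ḃ^s_{∞,1}(ℝ^d)`. -/
def besovNorm (φ : Generator d) (s : ℝ) (f : DotDistribution d) : ℝ≥0∞ :=
  ∑' j : ℤ, (2 : ℝ≥0∞) ^ ((j : ℝ) * s) * supNorm (φ.block j f)

/-- The norm of the homogeneous Vishik space `Ḃ^β_P(ℝ^d)`. -/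
def vishikNorm (φ : Generator d) (P : ℝ → ℝ) (β : ℝ) (f : DotDistribution d) : ℝ≥0∞ :=
  ⨆ N : ℕ, (∑' j : Set.Iic (N : ℤ),
    (2 : ℝ≥0∞) ^ (((j : ℤ) : ℝ) * β) * supNorm (φ.block j f)) / ENNReal.ofReal (P N)

end Vishik

end

/-! Write a_j for the sup norm of the j-th block of f. All Besov and Vishik norms are weighted sums
of the a_j, and so, up to constants, is the K-functional: K(t) ≈ ∑_j min(2^{j(β-κ)}, t 2^{jβ}) a_j
(`kSeq`). The lower bound is the blockwise triangle inequality. For the upper bound, f is cut at the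
frequency 2^N with 2^{-Nκ} ≈ t, where the two weights cross. The low-pass operator is defined by
duality, so no convergence of the Littlewood–Paley series is needed, and it is bounded on blocks
uniformly in N because the L¹ norm of its kernel is invariant under dilation
(`exists_kFunctional_le`).

Since t y_P(1/t) = inf_{p>1} P(p) t^{1-1/p}, control of the second quantity means K(t) ≤ A P(p)
t^{1-1/p} for all t > 0 and p > 1. Three inequalities between sequence quantities then form a cycle.
Besov supremum to K: min(x, y) ≤ x^{1/p} y^{1-1/p} produces the smoothness α = β - κ/p
(`exists_yudovichSup_kSeq_le`). K to the maximum: t = 2^{-Nκ}, p = N + 2 gives the Vishik partial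
sums, and t = 2^{Mκ} with p close to 1 gives the β - κ norm (`vishikSeq_le_yudovichSup`,
`besovSeq_le_yudovichSup`). Maximum to Besov supremum: 2^{-jε}, with ε = β - α, decays geometrically
over shells of length 1/ε, which beats the polynomial growth of P (`exists_besovSup_le`).

The extrapolation norm is compared with the K-quantity for general K. Monotonicity of K recovers
K(t) from the integral over (t, ∞), and conversely the bounds with exponents above and below p make
the integral converge at 0 and at ∞ (`le_interpSeq`, `interpSeq_le`). -/

noncomputable section

namespace Vishik

/-! ### Growth functions -/

namespace GrowthClass

variable {κ : ℝ} {P : ℝ → ℝ}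

/-- A doubling function grows at most polynomially. -/
theorem exists_polynomial_growth (hP : GrowthClass κ P) :
    ∃ m : ℕ, ∀ l p : ℝ, 1 ≤ l → 0 ≤ p → P (l * p) ≤ (2 * l) ^ m * P p := by
  obtain ⟨C, hC⟩ := hP.doubling
  obtain ⟨m, hm⟩ := pow_unbounded_of_one_lt C (one_lt_two (α := ℝ))
  have hdyadic : ∀ (n : ℕ) (p : ℝ), 0 ≤ p → P (2 ^ n * p) ≤ (2 ^ m) ^ n * P p := by
    intro n p hp
    induction n with
    | zero => simp
    | succ n ih =>
      have hpos := hP.pos (2 ^ n * p) (by positivity)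
      calc P (2 ^ (n + 1) * p) = P (2 * (2 ^ n * p)) := by ring_nf
        _ ≤ C * P (2 ^ n * p) := hC _ (by positivity)
        _ ≤ 2 ^ m * P (2 ^ n * p) := by gcongr
        _ ≤ 2 ^ m * ((2 ^ m) ^ n * P p) := by gcongr
        _ = _ := by ring
  refine ⟨m, fun l p hl hp => ?_⟩
  obtain ⟨n, hn1, hn2⟩ := exists_nat_pow_near hl (one_lt_two (α := ℝ))
  have hpos := hP.pos p hp
  calc P (l * p) ≤ P (2 ^ (n + 1) * p) :=
        hP.mono (Set.mem_Ici.2 (by positivity)) (Set.mem_Ici.2 (by positivity)) (by gcongr)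
    _ ≤ (2 ^ m) ^ (n + 1) * P p := hdyadic _ _ hp
    _ = (2 * 2 ^ n) ^ m * P p := by rw [← pow_mul, mul_comm m, pow_mul, pow_succ']
    _ ≤ _ := by gcongr

theorem exists_dilation_bound (hP : GrowthClass κ P) (l : ℝ) :
    ∃ C : ℝ≥0, ∀ p : ℝ, 0 ≤ p → ∀ q ∈ Set.Icc 0 (l * p), P q ≤ C * P p := by
  obtain ⟨m, hm⟩ := hP.exists_polynomial_growth
  refine ⟨⟨(2 * max 1 l) ^ m, by positivity⟩, fun p hp q hq => ?_⟩
  refine le_trans (hP.mono hq.1 (Set.mem_Ici.2 (by positivity)) ?_)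
    (hm (max 1 l) p (le_max_left _ _) hp)
  exact hq.2.trans (by gcongr; exact le_max_right _ _)

/-- Doubling says nothing at p = 0, so for p < 1 the additive shift is absorbed by the ratio
P(1)/P(0), finite because P(0) > 0. -/
theorem exists_affine_bound (hP : GrowthClass κ P) (l b : ℝ) :
    ∃ C : ℝ≥0, ∀ p : ℝ, 0 ≤ p → ∀ q ∈ Set.Icc 0 (l * p + b), P q ≤ C * P p := by
  obtain ⟨C, hC⟩ := hP.exists_dilation_bound (|l| + |b|)
  have h0 := hP.pos 0 le_rfl
  have h1 := hP.pos 1 zero_le_one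
  refine ⟨C * max 1 ⟨P 1 / P 0, by positivity⟩, fun p hp q hq => ?_⟩
  have hpp := hP.pos p hp
  have h2 : P q ≤ C * P (max 1 p) := by
    refine hC _ (by positivity) q ⟨hq.1, hq.2.trans ?_⟩
    have e1 : l * p ≤ |l| * max 1 p :=
      (mul_le_mul_of_nonneg_right (le_abs_self l) hp).trans (by gcongr; exact le_max_right _ _)
    have e2 : b ≤ |b| * max 1 p :=
      (le_abs_self b).trans (le_mul_of_one_le_right (abs_nonneg b) (le_max_left _ _))
    linarith
  have h3 : P (max 1 p) ≤ max 1 (P 1 / P 0) * P p := by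
    rcases le_total 1 p with h | h
    · rw [max_eq_right h]
      exact le_mul_of_one_le_left hpp.le (le_max_left _ _)
    · rw [max_eq_left h]
      calc P 1 = P 1 / P 0 * P 0 := by field_simp
        _ ≤ max 1 (P 1 / P 0) * P p := by
          gcongr
          · exact le_max_right _ _
          · exact hP.mono (Set.mem_Ici.2 le_rfl) (Set.mem_Ici.2 hp) hp
  calc P q ≤ C * P (max 1 p) := h2
    _ ≤ C * (max 1 (P 1 / P 0) * P p) := by gcongr
    _ = _ := by push_cast; rw [mul_assoc]; rfl

/-- The Yudovich function rescaled as in the denominator of the characterization by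
`K`-functionals. -/
theorem mul_yudovich_eq (P : ℝ → ℝ) {t : ℝ} (ht : 0 < t) :
    t * yudovich P (1 / t) = ⨅ p : Set.Ioi (1 : ℝ), P p * t ^ (1 - 1 / (p : ℝ)) := by
  rw [yudovich, Real.mul_iInf_of_nonneg ht.le]
  congr 1
  ext p
  rw [one_div t, Real.inv_rpow ht.le, Real.rpow_sub ht, Real.rpow_one]
  field_simp

theorem bddBelow_range (hP : GrowthClass κ P) {t : ℝ} (ht : 0 < t) :
    BddBelow (Set.range fun p : Set.Ioi (1 : ℝ) => P p * t ^ (1 - 1 / (p : ℝ))) := by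
  refine ⟨0, ?_⟩
  rintro _ ⟨p, rfl⟩
  have := hP.pos p (zero_le_one.trans (le_of_lt p.2))
  positivity

theorem mul_yudovich_le (hP : GrowthClass κ P) {t : ℝ} (ht : 0 < t) {p : ℝ} (hp : 1 < p) :
    t * yudovich P (1 / t) ≤ P p * t ^ (1 - 1 / p) := by
  rw [mul_yudovich_eq P ht]
  exact ciInf_le (hP.bddBelow_range ht) (⟨p, hp⟩ : Set.Ioi (1 : ℝ))

/-- The exponents 1 - 1/p lie in (0, 1), so P(0) min(1, t) bounds the infimum from below. Positivity
makes division by this quantity reversible. -/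
theorem mul_yudovich_pos (hP : GrowthClass κ P) {t : ℝ} (ht : 0 < t) :
    0 < t * yudovich P (1 / t) := by
  have h0 := hP.pos 0 le_rfl
  refine lt_of_lt_of_le (b := P 0 * min 1 t) (by positivity) ?_
  rw [mul_yudovich_eq P ht]
  have : Nonempty (Set.Ioi (1 : ℝ)) := ⟨⟨2, by norm_num⟩⟩
  refine le_ciInf fun ⟨p, hp⟩ => ?_
  have hp1 : (1 : ℝ) < p := hp
  have hp0 : 0 < p := by linarith
  have h2 : 1 / p ≤ 1 := by rw [div_le_one hp0]; exact hp1.le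
  have h3 : 0 < 1 / p := by positivity
  have h1 : P 0 ≤ P p := hP.mono (Set.mem_Ici.2 le_rfl) (Set.mem_Ici.2 hp0.le) hp0.le
  refine mul_le_mul h1 ?_ (by positivity) (h0.le.trans h1)
  rcases le_total 1 t with h | h
  · exact (min_le_left _ _).trans (Real.one_le_rpow h (by linarith))
  · refine (min_le_right _ _).trans ?_
    conv_lhs => rw [← Real.rpow_one t]
    exact Real.rpow_le_rpow_of_exponent_ge ht h (by linarith)

/-- Moves the real infimum over p inside `ENNReal.ofReal`; the degenerate constants 0 and ∞ are
treated apart because X is divided by c. -/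
theorem le_mul_ofReal_mul_yudovich (hP : GrowthClass κ P) {t : ℝ} (ht : 0 < t) {X c : ℝ≥0∞}
    (h : ∀ p : ℝ, 1 < p → X ≤ c * ENNReal.ofReal (P p * t ^ (1 - 1 / p))) :
    X ≤ c * ENNReal.ofReal (t * yudovich P (1 / t)) := by
  have hY := hP.mul_yudovich_pos ht
  rcases eq_or_ne c ⊤ with rfl | hc
  · rw [ENNReal.top_mul (by simpa using hY)]
    exact le_top
  rcases eq_or_ne c 0 with rfl | hc0
  · simpa using h 2 (by norm_num)
  rw [mul_comm, ← ENNReal.div_le_iff hc0 hc]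
  have hX : X / c ≠ ⊤ := by
    refine ENNReal.div_ne_top (ne_top_of_le_ne_top ?_ (h 2 (by norm_num))) hc0
    exact ENNReal.mul_ne_top hc ENNReal.ofReal_ne_top
  rw [← ENNReal.ofReal_toReal hX]
  refine ENNReal.ofReal_le_ofReal ?_
  rw [mul_yudovich_eq P ht]
  have : Nonempty (Set.Ioi (1 : ℝ)) := ⟨⟨2, by norm_num⟩⟩
  refine le_ciInf fun ⟨p, hp⟩ => ?_
  have hpos := hP.pos p (zero_le_one.trans (le_of_lt hp))
  refine ENNReal.toReal_le_of_le_ofReal (by positivity) ?_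
  rw [ENNReal.div_le_iff hc0 hc, mul_comm]
  exact h p hp

end GrowthClass

/-! ### Powers of two in `[0, ∞]` -/

theorem two_rpow_add (x y : ℝ) : (2 : ℝ≥0∞) ^ (x + y) = 2 ^ x * 2 ^ y :=
  ENNReal.rpow_add _ _ two_ne_zero ENNReal.ofNat_ne_top

theorem two_rpow_le {x y : ℝ} (h : x ≤ y) : (2 : ℝ≥0∞) ^ x ≤ 2 ^ y :=
  ENNReal.rpow_le_rpow_of_exponent_le one_le_two h

theorem two_rpow_ne_top (x : ℝ) : (2 : ℝ≥0∞) ^ x ≠ ⊤ :=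
  ENNReal.rpow_ne_top_of_ne_zero two_ne_zero ENNReal.ofNat_ne_top

theorem two_rpow_ne_zero (x : ℝ) : (2 : ℝ≥0∞) ^ x ≠ 0 :=
  (ENNReal.rpow_pos two_pos ENNReal.ofNat_ne_top).ne'

theorem ofReal_two_rpow (x : ℝ) : ENNReal.ofReal ((2 : ℝ) ^ x) = 2 ^ x := by
  rw [← ENNReal.ofReal_rpow_of_pos two_pos, ENNReal.ofReal_ofNat]

theorem exists_eq_two_rpow {t : ℝ} (ht : 0 < t) : ∃ τ : ℝ, t = 2 ^ τ :=
  ⟨Real.logb 2 t, (Real.rpow_logb two_pos (by norm_num) ht).symm⟩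

/-! ### Weighted sequence norms -/

/-- The norm of the weighted sequence space underlying `Ḃ^s_{∞,1}`. -/
def besovSeq (s : ℝ) (a : ℤ → ℝ≥0∞) : ℝ≥0∞ := ∑' j : ℤ, (2 : ℝ≥0∞) ^ ((j : ℝ) * s) * a j

/-- The sequence norm underlying the homogeneous Vishik space. -/
def vishikSeq (P : ℝ → ℝ) (β : ℝ) (a : ℤ → ℝ≥0∞) : ℝ≥0∞ :=
  ⨆ N : ℕ, (∑' j : Set.Iic (N : ℤ), (2 : ℝ≥0∞) ^ (((j : ℤ) : ℝ) * β) * a j) /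
    ENNReal.ofReal (P N)

/-- The `K`-functional of the pair of weighted sequence spaces with parameters `β - κ`, `β`. -/
def kSeq (β κ t : ℝ) (a : ℤ → ℝ≥0∞) : ℝ≥0∞ :=
  ∑' j : ℤ, min ((2 : ℝ≥0∞) ^ ((j : ℝ) * (β - κ))) (ENNReal.ofReal t * 2 ^ ((j : ℝ) * β)) * a j

/-- The quantity `sup_t K(t) / (t y_P(1/t))`. -/
def yudovichSup (P : ℝ → ℝ) (K : ℝ → ℝ≥0∞) : ℝ≥0∞ :=
  ⨆ t ∈ Set.Ioi (0 : ℝ), K t / ENNReal.ofReal (t * yudovich P (1 / t))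

/-- The quantity `sup_α ‖a‖_α / P(1/(β-α))`. -/
def besovSup (P : ℝ → ℝ) (β κ : ℝ) (a : ℤ → ℝ≥0∞) : ℝ≥0∞ :=
  ⨆ α ∈ Set.Ioo (β - κ) β, besovSeq α a / ENNReal.ofReal (P (1 / (β - α)))

variable {κ β : ℝ} {P : ℝ → ℝ}

theorem le_yudovichSup_mul (hP : GrowthClass κ P) (K : ℝ → ℝ≥0∞) {t : ℝ} (ht : 0 < t) :
    K t ≤ yudovichSup P K * ENNReal.ofReal (t * yudovich P (1 / t)) := by
  have hY : ENNReal.ofReal (t * yudovich P (1 / t)) ≠ 0 := by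
    simpa using hP.mul_yudovich_pos ht
  rw [← ENNReal.div_le_iff hY ENNReal.ofReal_ne_top]
  exact le_iSup₂ (f := fun (t : ℝ) (_ : t ∈ Set.Ioi (0 : ℝ)) =>
    K t / ENNReal.ofReal (t * yudovich P (1 / t))) t ht

/-- Replaces the Yudovich function by a two-parameter family of power bounds, the form in which
every upper estimate is proved. -/
theorem yudovichSup_le (hP : GrowthClass κ P) {K : ℝ → ℝ≥0∞} {A : ℝ≥0∞}
    (h : ∀ t p : ℝ, 0 < t → 1 < p → K t ≤ A * ENNReal.ofReal (P p * t ^ (1 - 1 / p))) :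
    yudovichSup P K ≤ A := by
  refine iSup₂_le fun t ht => ?_
  have hY : ENNReal.ofReal (t * yudovich P (1 / t)) ≠ 0 := by
    simpa using hP.mul_yudovich_pos ht
  rw [ENNReal.div_le_iff hY ENNReal.ofReal_ne_top]
  exact hP.le_mul_ofReal_mul_yudovich ht fun p hp => h t p ht hp

theorem le_yudovichSup_mul_rpow (hP : GrowthClass κ P) (K : ℝ → ℝ≥0∞) {t p : ℝ} (ht : 0 < t)
    (hp : 1 < p) : K t ≤ yudovichSup P K * ENNReal.ofReal (P p * t ^ (1 - 1 / p)) :=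
  (le_yudovichSup_mul hP K ht).trans (mul_le_mul_right (ENNReal.ofReal_le_ofReal (hP.mul_yudovich_le ht hp)) _)

theorem besovSeq_le_besovSup_mul (hP : GrowthClass κ P) (a : ℤ → ℝ≥0∞) {α : ℝ}
    (hα : α ∈ Set.Ioo (β - κ) β) :
    besovSeq α a ≤ besovSup P β κ a * ENNReal.ofReal (P (1 / (β - α))) := by
  have h : 0 < β - α := sub_pos.2 hα.2
  have hY : ENNReal.ofReal (P (1 / (β - α))) ≠ 0 := by
    simpa using hP.pos (1 / (β - α)) (by positivity)
  rw [← ENNReal.div_le_iff hY ENNReal.ofReal_ne_top]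
  exact le_iSup₂ (f := fun (α : ℝ) (_ : α ∈ Set.Ioo (β - κ) β) =>
    besovSeq α a / ENNReal.ofReal (P (1 / (β - α)))) α hα

theorem tsum_Iic_le_vishikSeq_mul (hP : GrowthClass κ P) (a : ℤ → ℝ≥0∞) (N : ℕ) :
    ∑' j : Set.Iic (N : ℤ), (2 : ℝ≥0∞) ^ (((j : ℤ) : ℝ) * β) * a j ≤
      vishikSeq P β a * ENNReal.ofReal (P N) := by
  have hY : ENNReal.ofReal (P N) ≠ 0 := by simpa using hP.pos N (by positivity)
  rw [← ENNReal.div_le_iff hY ENNReal.ofReal_ne_top]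
  exact le_iSup (fun N : ℕ => (∑' j : Set.Iic (N : ℤ), (2 : ℝ≥0∞) ^ (((j : ℤ) : ℝ) * β) * a j) /
    ENNReal.ofReal (P N)) N

/-! ### Inequalities between the sequence quantities -/

theorem min_two_rpow_le {θ x y : ℝ} (h0 : 0 ≤ θ) (h1 : θ ≤ 1) :
    min ((2 : ℝ≥0∞) ^ x) (2 ^ y) ≤ 2 ^ ((1 - θ) * x + θ * y) := by
  rcases le_total x y with h | h
  · exact (min_le_left _ _).trans (two_rpow_le (by nlinarith))
  · exact (min_le_right _ _).trans (two_rpow_le (by nlinarith))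

/-- The geometric mean of the two weights with exponents 1/p and 1 - 1/p is t^{1-1/p} 2^{j(β-κ/p)}.
For α = β - κ/p one has 1/(β-α) = p/κ, and doubling compares P(p/κ) with P(p). -/
theorem exists_yudovichSup_kSeq_le (hκ : 0 < κ) (β : ℝ) (hP : GrowthClass κ P) :
    ∃ C : ℝ≥0, ∀ a : ℤ → ℝ≥0∞,
      yudovichSup P (fun t => kSeq β κ t a) ≤ C * besovSup P β κ a := by
  obtain ⟨C, hC⟩ := hP.exists_dilation_bound (1 / κ)
  refine ⟨C, fun a => yudovichSup_le hP fun t p ht hp => ?_⟩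
  have hp0 : 0 < p := by linarith
  have hp1 : 1 / p ≤ 1 := by rw [div_le_one hp0]; exact hp.le
  have hp1' : 1 / p < 1 := by rw [div_lt_one hp0]; exact hp
  have hp2 : 0 < 1 / p := by positivity
  obtain ⟨τ, rfl⟩ := exists_eq_two_rpow ht
  have hα : β - κ / p ∈ Set.Ioo (β - κ) β := by
    have : κ / p = κ * (1 / p) := by ring
    constructor
    · rw [this]; nlinarith
    · rw [this]; nlinarith
  have hw : ∀ j : ℤ, min ((2 : ℝ≥0∞) ^ ((j : ℝ) * (β - κ)))
      (ENNReal.ofReal (2 ^ τ) * 2 ^ ((j : ℝ) * β)) ≤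
      2 ^ (τ * (1 - 1 / p)) * 2 ^ ((j : ℝ) * (β - κ / p)) := by
    intro j
    rw [ofReal_two_rpow, ← two_rpow_add, ← two_rpow_add]
    refine (min_two_rpow_le (θ := 1 - 1 / p) (by linarith) (by linarith)).trans
      (two_rpow_le (le_of_eq ?_))
    field_simp
    ring
  have hbound := besovSeq_le_besovSup_mul hP a hα
  have hPp : P (1 / (β - (β - κ / p))) ≤ C * P p := by
    refine hC p hp0.le _ ⟨by simp; positivity, le_of_eq ?_⟩
    rw [sub_sub_cancel]
    field_simp
  have hPpos := hP.pos p hp0.le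
  calc kSeq β κ (2 ^ τ) a
      ≤ ∑' j : ℤ, 2 ^ (τ * (1 - 1 / p)) * (2 ^ ((j : ℝ) * (β - κ / p)) * a j) := by
        refine ENNReal.tsum_le_tsum fun j => ?_
        rw [← mul_assoc]
        gcongr
        exact hw j
    _ = 2 ^ (τ * (1 - 1 / p)) * besovSeq (β - κ / p) a := by rw [ENNReal.tsum_mul_left]; rfl
    _ ≤ 2 ^ (τ * (1 - 1 / p)) * (besovSup P β κ a * ENNReal.ofReal (C * P p)) := by
        gcongr
        exact hbound.trans (by gcongr)
    _ = _ := by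
        rw [ENNReal.ofReal_mul C.coe_nonneg, ENNReal.ofReal_mul hPpos.le, ← Real.rpow_mul two_pos.le,
          ofReal_two_rpow, ENNReal.ofReal_coe_nnreal]
        ring

theorem tsum_indicator_Iic (N : ℕ) (b : ℤ → ℝ≥0∞) :
    ∑' j : ℤ, (Set.Iic (N : ℤ)).indicator b j = ∑' j : Set.Iic (N : ℤ), b j :=
  (tsum_subtype (Set.Iic (N : ℤ)) b).symm

theorem summable_polynomial_mul_geometric (m : ℕ) (κ : ℝ) :
    Summable fun k : ℕ => ((2 : ℝ) ^ k)⁻¹ * (2 * (k + 1 + κ)) ^ m := by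
  have h : ∀ i : ℕ, Summable fun k : ℕ => (k : ℝ) ^ i * (1 / 2) ^ k := fun i =>
    summable_pow_mul_geometric_of_norm_lt_one i (by norm_num)
  have h2 : Summable fun k : ℕ => ∑ i ∈ Finset.range (m + 1),
      (2 ^ m * (1 + κ) ^ (m - i) * (m.choose i : ℝ)) * ((k : ℝ) ^ i * (1 / 2) ^ k) :=
    summable_sum fun i _ => (h i).mul_left _
  refine h2.congr fun k => ?_
  rw [mul_pow, add_assoc, add_pow, Finset.mul_sum, Finset.mul_sum]
  refine Finset.sum_congr rfl fun i _ => ?_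
  rw [one_div, inv_pow]
  ring

theorem exists_besovSup_le (hκ : 0 < κ) (β : ℝ) (hP : GrowthClass κ P) :
    ∃ C : ℝ≥0, ∀ a : ℤ → ℝ≥0∞,
      besovSup P β κ a ≤ C * max (vishikSeq P β a) (besovSeq (β - κ) a) := by
  obtain ⟨m, hm⟩ := hP.exists_polynomial_growth
  set c : ℕ → ℝ := fun k => ((2 : ℝ) ^ k)⁻¹ * (2 * (k + 1 + κ)) ^ m with hc
  have hc0 : ∀ k, 0 ≤ c k := fun k => by positivity
  have hsum : Summable c := summable_polynomial_mul_geometric m κ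
  have hP0 := hP.pos 0 le_rfl
  -- The term 1/P(0) pays for the frequencies j ≤ 0, and the series of c k for the shells of
  -- positive frequencies.
  refine ⟨((P 0)⁻¹ + ∑' k, c k).toNNReal, fun a => ?_⟩
  refine iSup₂_le fun α hα => ?_
  set Q := max (vishikSeq P β a) (besovSeq (β - κ) a) with hQ
  obtain ⟨ε, hε⟩ : ∃ ε, ε = β - α := ⟨_, rfl⟩
  have hε0 : 0 < ε := by rw [hε]; linarith [hα.2]
  have hεκ : ε < κ := by rw [hε]; linarith [hα.1]
  have hPε := hP.pos (1 / ε) (by positivity)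
  rw [← hε, ENNReal.div_le_iff (by simpa using hPε) ENNReal.ofReal_ne_top]
  -- The shell k ≤ jε < k + 1 lies in j ≤ N k, and there 2^{-jε} ≤ 2^{-k}. Each shell is enlarged to
  -- the whole half-line j ≤ N k, whose sum is a Vishik partial sum.
  let N : ℕ → ℕ := fun k => ⌈(k + 1) / ε⌉₊
  have hterm : ∀ j : ℤ, (2 : ℝ≥0∞) ^ ((j : ℝ) * α) * a j ≤
      2 ^ ((j : ℝ) * (β - κ)) * a j + ∑' k : ℕ, ENNReal.ofReal ((2 : ℝ) ^ k)⁻¹ *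
        (Set.Iic (N k : ℤ)).indicator (fun j : ℤ => (2 : ℝ≥0∞) ^ ((j : ℝ) * β) * a j) j := by
    intro j
    rcases le_total j 0 with hj | hj
    · refine le_trans ?_ le_self_add
      gcongr ?_ * _
      have hj' : (j : ℝ) ≤ 0 := by exact_mod_cast hj
      exact two_rpow_le (by nlinarith)
    · refine le_trans ?_ le_add_self
      have hj' : (0 : ℝ) ≤ j := by exact_mod_cast hj
      refine le_trans ?_ (ENNReal.le_tsum ⌊(j : ℝ) * ε⌋₊)
      have h1 : ((⌊(j : ℝ) * ε⌋₊ : ℕ) : ℝ) ≤ j * ε := Nat.floor_le (by positivity)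
      have h2 : (j : ℝ) * ε < (⌊(j : ℝ) * ε⌋₊ : ℕ) + 1 := Nat.lt_floor_add_one _
      have hmem : j ∈ Set.Iic (N ⌊(j : ℝ) * ε⌋₊ : ℤ) := by
        have h3 : (j : ℝ) ≤ (N ⌊(j : ℝ) * ε⌋₊ : ℕ) := by
          refine le_trans ?_ (Nat.le_ceil _)
          rw [le_div_iff₀ hε0]
          exact h2.le
        rw [Set.mem_Iic]
        exact_mod_cast h3
      rw [Set.indicator_of_mem hmem, ← mul_assoc]
      gcongr ?_ * _
      rw [← Real.rpow_natCast, ← Real.rpow_neg two_pos.le, ofReal_two_rpow, ← two_rpow_add]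
      refine two_rpow_le ?_
      have : α = β - ε := by rw [hε]; ring
      rw [this]
      nlinarith
  have hN : ∀ k : ℕ, P (N k) ≤ (2 * (k + 1 + κ)) ^ m * P (1 / ε) := by
    intro k
    refine le_trans ?_ (hm (k + 1 + κ) (1 / ε) (by linarith [(k.cast_nonneg : (0 : ℝ) ≤ k)])
      (by positivity))
    refine hP.mono (Set.mem_Ici.2 (by positivity)) (Set.mem_Ici.2 (by positivity)) ?_
    have h1 : ((N k : ℕ) : ℝ) < (k + 1) / ε + 1 := Nat.ceil_lt_add_one (by positivity)
    -- Because ε < κ, the summand κ in the dilation factor absorbs the rounding in the ceiling.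
    have h2 : 1 ≤ κ / ε := by rw [le_div_iff₀ hε0]; linarith
    have h3 : ((k : ℝ) + 1 + κ) * (1 / ε) = (k + 1) / ε + κ / ε := by ring
    rw [h3]
    linarith
  have hconst : (1 : ℝ≥0∞) ≤ ENNReal.ofReal (P 0)⁻¹ * ENNReal.ofReal (P (1 / ε)) := by
    rw [← ENNReal.ofReal_mul (by positivity), ENNReal.one_le_ofReal]
    have : P 0 ≤ P (1 / ε) :=
      hP.mono (Set.mem_Ici.2 le_rfl) (Set.mem_Ici.2 (by positivity)) (by positivity)
    rw [inv_mul_eq_div, le_div_iff₀ hP0]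
    linarith
  calc besovSeq α a
      ≤ ∑' j : ℤ, (2 ^ ((j : ℝ) * (β - κ)) * a j + ∑' k : ℕ, ENNReal.ofReal ((2 : ℝ) ^ k)⁻¹ *
        (Set.Iic (N k : ℤ)).indicator (fun j : ℤ => (2 : ℝ≥0∞) ^ ((j : ℝ) * β) * a j) j) :=
        ENNReal.tsum_le_tsum hterm
    _ = besovSeq (β - κ) a + ∑' k : ℕ, ENNReal.ofReal ((2 : ℝ) ^ k)⁻¹ *
        ∑' j : Set.Iic (N k : ℤ), (2 : ℝ≥0∞) ^ (((j : ℤ) : ℝ) * β) * a j := by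
        rw [ENNReal.tsum_add, ENNReal.tsum_comm]
        simp_rw [ENNReal.tsum_mul_left, tsum_indicator_Iic]
        rfl
    _ ≤ Q + ∑' k : ℕ, ENNReal.ofReal ((2 : ℝ) ^ k)⁻¹ *
        (Q * ENNReal.ofReal ((2 * (k + 1 + κ)) ^ m * P (1 / ε))) := by
        gcongr with k
        · exact le_max_right _ _
        · refine (tsum_Iic_le_vishikSeq_mul hP a (N k)).trans ?_
          gcongr
          · exact le_max_left _ _
          · exact hN k
    _ = Q + ∑' k : ℕ, ENNReal.ofReal (c k) * (Q * ENNReal.ofReal (P (1 / ε))) := by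
        congr 1
        refine tsum_congr fun k => ?_
        rw [hc, ENNReal.ofReal_mul (by positivity), ENNReal.ofReal_mul (by positivity)]
        ring
    _ ≤ Q * (ENNReal.ofReal (P 0)⁻¹ * ENNReal.ofReal (P (1 / ε))) +
        ENNReal.ofReal (∑' k, c k) * (Q * ENNReal.ofReal (P (1 / ε))) := by
        rw [ENNReal.tsum_mul_right, ENNReal.ofReal_tsum_of_nonneg hc0 hsum]
        gcongr
        exact le_mul_of_one_le_right' hconst
    _ = _ := by
        rw [ENNReal.ofNNReal_toNNReal, ENNReal.ofReal_add (by positivity) (tsum_nonneg hc0)]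
        ring

theorem vishikSeq_le_yudovichSup (hκ : 0 < κ) (β : ℝ) (hP : GrowthClass κ P) :
    ∃ C : ℝ≥0, ∀ a : ℤ → ℝ≥0∞,
      vishikSeq P β a ≤ C * yudovichSup P (fun t => kSeq β κ t a) := by
  obtain ⟨C, hC⟩ := hP.exists_affine_bound 1 2
  refine ⟨C * 2 ^ (2 * κ), fun a => iSup_le fun N => ?_⟩
  have hPN := hP.pos N (by positivity)
  rw [ENNReal.div_le_iff (by simpa using hPN) ENNReal.ofReal_ne_top]
  -- At t = 2^{-Nκ} the weights cross at j = N, so the minimum is t 2^{jβ} for j ≤ N. With p = N +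
  -- 2, which exceeds 1 even at N = 0, t^{1-1/p} is t times a factor bounded in N.
  have hK := le_yudovichSup_mul_rpow hP (fun t => kSeq β κ t a) (t := 2 ^ (-(N * κ)))
    (p := N + 2) (by positivity) (by linarith [(N.cast_nonneg : (0 : ℝ) ≤ N)])
  have hlow : 2 ^ (-(N * κ)) *
      ∑' j : Set.Iic (N : ℤ), (2 : ℝ≥0∞) ^ (((j : ℤ) : ℝ) * β) * a j ≤
      kSeq β κ (2 ^ (-(N * κ))) a := by
    rw [← ENNReal.tsum_mul_left]
    refine le_trans (ENNReal.tsum_le_tsum fun j => ?_) (ENNReal.tsum_comp_le_tsum_of_injective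
      (Subtype.val_injective (p := fun j => j ∈ Set.Iic (N : ℤ))) _)
    have hj : ((j : ℤ) : ℝ) ≤ N := by exact_mod_cast j.2
    rw [← mul_assoc, ofReal_two_rpow, ← two_rpow_add]
    gcongr ?_ * _
    exact le_min (two_rpow_le (by nlinarith)) le_rfl
  have hPC : P (N + 2) ≤ C * P N := hC N (by positivity) _ ⟨by positivity, by linarith⟩
  have hPN2 := hP.pos (N + 2) (by positivity)
  set S := ∑' j : Set.Iic (N : ℤ), (2 : ℝ≥0∞) ^ (((j : ℤ) : ℝ) * β) * a j
  set Q := yudovichSup P (fun t => kSeq β κ t a)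
  have hexp : (2 : ℝ≥0∞) ^ (N * κ) * 2 ^ (-(N * κ) * (1 - 1 / ((N : ℝ) + 2))) ≤ 2 ^ (2 * κ) := by
    rw [← two_rpow_add]
    refine two_rpow_le ?_
    have h1 : N * κ + -(N * κ) * (1 - 1 / ((N : ℝ) + 2)) = κ * (N / (N + 2)) := by
      field_simp
      ring
    have h2 : (N : ℝ) / (N + 2) ≤ 1 := by
      rw [div_le_one (by positivity)]
      linarith
    rw [h1]
    nlinarith
  calc S = 2 ^ (N * κ) * (2 ^ (-(N * κ)) * S) := by
        rw [← mul_assoc, ← two_rpow_add, add_neg_cancel, ENNReal.rpow_zero, one_mul]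
    _ ≤ 2 ^ (N * κ) * (Q * ENNReal.ofReal (P (N + 2) *
        (2 ^ (-(N * κ))) ^ (1 - 1 / ((N : ℝ) + 2)))) := by
        exact mul_le_mul_right (hlow.trans hK) _
    _ = (2 ^ (N * κ) * 2 ^ (-(N * κ) * (1 - 1 / ((N : ℝ) + 2)))) *
        (Q * ENNReal.ofReal (P (N + 2))) := by
        rw [ENNReal.ofReal_mul hPN2.le, ← Real.rpow_mul two_pos.le, ofReal_two_rpow]
        ring
    _ ≤ 2 ^ (2 * κ) * (Q * ENNReal.ofReal (C * P N)) := by gcongr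
    _ = _ := by
        rw [ENNReal.ofReal_mul C.coe_nonneg, ENNReal.ofReal_coe_nnreal, ENNReal.coe_mul,
          ENNReal.coe_rpow_of_ne_zero two_ne_zero, ENNReal.coe_ofNat]
        ring

theorem besovSeq_le_yudovichSup (hκ : 0 < κ) (β : ℝ) (hP : GrowthClass κ P) :
    ∃ C : ℝ≥0, ∀ a : ℤ → ℝ≥0∞,
      besovSeq (β - κ) a ≤ C * yudovichSup P (fun t => kSeq β κ t a) := by
  have hP2 := hP.pos 2 (by positivity)
  refine ⟨(P 2).toNNReal * 2 ^ κ, fun a => ?_⟩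
  rw [besovSeq, ENNReal.tsum_eq_iSup_sum]
  refine iSup_le fun F => ?_
  obtain ⟨M, hM⟩ : ∃ M : ℕ, ∀ j ∈ F, -(M : ℤ) ≤ j := by
    refine ⟨∑ i ∈ F, i.natAbs, fun j hj => ?_⟩
    have := Finset.single_le_sum (f := Int.natAbs) (fun i _ => Nat.zero_le _) hj
    omega
  have hM0 : (0 : ℝ) ≤ M := M.cast_nonneg
  -- At t = 2^{Mκ} the minimum is 2^{j(β-κ)} for all j ≥ -M. Here 1 - 1/p = 1/(M + 2), so t^{1-1/p}
  -- ≤ 2^κ, while p ≤ 2 keeps P(p) ≤ P(2).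
  obtain ⟨p, hp⟩ : ∃ p : ℝ, p = 1 + 1 / (M + 1) := ⟨_, rfl⟩
  have hp1 : 1 < p := by rw [hp]; have : 0 < 1 / ((M : ℝ) + 1) := by positivity
                         linarith
  have hp2 : p ≤ 2 := by
    have : 1 / ((M : ℝ) + 1) ≤ 1 := by rw [div_le_one (by positivity)]; linarith
    rw [hp]; linarith
  have hK := le_yudovichSup_mul_rpow hP (fun t => kSeq β κ t a) (t := 2 ^ (M * κ))
    (by positivity) hp1
  have hlow : ∑ j ∈ F, (2 : ℝ≥0∞) ^ ((j : ℝ) * (β - κ)) * a j ≤ kSeq β κ (2 ^ (M * κ)) a := by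
    refine le_trans (Finset.sum_le_sum fun j hj => ?_) (ENNReal.sum_le_tsum F)
    have hj : -(M : ℝ) ≤ j := by exact_mod_cast hM j hj
    gcongr ?_ * _
    rw [ofReal_two_rpow, ← two_rpow_add]
    exact le_min le_rfl (two_rpow_le (by nlinarith))
  refine hlow.trans (hK.trans ?_)
  rw [mul_comm]
  gcongr
  rw [ENNReal.coe_mul, ENNReal.coe_rpow_of_ne_zero two_ne_zero, ENNReal.coe_ofNat,
    ENNReal.ofNNReal_toNNReal, ENNReal.ofReal_mul (hP.pos p (by linarith)).le,
    ← Real.rpow_mul two_pos.le, ofReal_two_rpow]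
  refine mul_le_mul' (ENNReal.ofReal_le_ofReal ?_) (two_rpow_le ?_)
  · exact hP.mono (Set.mem_Ici.2 (by linarith)) (Set.mem_Ici.2 (by norm_num)) hp2
  · have h1 : 1 - 1 / p = 1 / (M + 2) := by
      rw [hp]
      field_simp
      ring
    have h2 : (M : ℝ) / (M + 2) ≤ 1 := by
      rw [div_le_one (by positivity)]
      linarith
    calc M * κ * (1 - 1 / p) = κ * (M / (M + 2)) := by rw [h1]; ring
      _ ≤ κ := by nlinarith

end Vishik

namespace Vishik

/-! ### Extrapolation of the interpolation norms -/

/-- The normalized interpolation norm as a functional of the `K`-functional. -/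
def interpSeq (K : ℝ → ℝ≥0∞) (θ p : ℝ) : ℝ≥0∞ :=
  ENNReal.ofReal ((θ * (1 - θ) * p) ^ (1 / p)) *
    (∫⁻ t in Set.Ioi (0 : ℝ), (ENNReal.ofReal (t ^ (-θ)) * K t) ^ p * ENNReal.ofReal t⁻¹) ^ (1 / p)

/-- The `Δ`-extrapolation norm as a functional of the `K`-functional. -/
def deltaSup (P : ℝ → ℝ) (K : ℝ → ℝ≥0∞) : ℝ≥0∞ :=
  ⨆ θ ∈ Set.Ioo (0 : ℝ) 1, interpSeq K θ (1 / (1 - θ)) / ENNReal.ofReal (P (1 / (1 - θ)))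

variable {κ : ℝ} {P : ℝ → ℝ} {K : ℝ → ℝ≥0∞}

theorem interp_integrand_eq (K : ℝ → ℝ≥0∞) {p s : ℝ} (hp : 1 < p) (hs : 0 < s) :
    (ENNReal.ofReal (s ^ (-(1 - 1 / p))) * K s) ^ p * ENNReal.ofReal s⁻¹ =
      ENNReal.ofReal (s ^ (-p)) * K s ^ p := by
  have hp0 : 0 < p := by linarith
  rw [ENNReal.mul_rpow_of_nonneg _ _ hp0.le, ENNReal.ofReal_rpow_of_pos (by positivity),
    mul_right_comm, ← ENNReal.ofReal_mul (by positivity), ← Real.rpow_mul hs.le,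
    ← Real.rpow_neg_one s, ← Real.rpow_add hs]
  congr 3
  field_simp
  ring

/-- For θ = 1 - 1/p the normalizing factor θ(1-θ)p collapses to 1 - 1/p, and the powers of s combine
to s^{-p}. -/
theorem interpSeq_eq (K : ℝ → ℝ≥0∞) {p : ℝ} (hp : 1 < p) :
    interpSeq K (1 - 1 / p) p = (ENNReal.ofReal (1 - 1 / p) *
      ∫⁻ s in Set.Ioi (0 : ℝ), ENNReal.ofReal (s ^ (-p)) * K s ^ p) ^ (1 / p) := by
  have hp0 : 0 < p := by linarith
  have hp1 : 1 / p < 1 := by rw [div_lt_one hp0]; exact hp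
  have h1 : (1 - 1 / p) * (1 - (1 - 1 / p)) * p = 1 - 1 / p := by field_simp; ring
  rw [interpSeq, h1, ENNReal.mul_rpow_of_nonneg _ _ (by positivity),
    ENNReal.ofReal_rpow_of_nonneg (by linarith) (by positivity)]
  congr 2
  exact MeasureTheory.setLIntegral_congr_fun measurableSet_Ioi
    fun s hs => interp_integrand_eq K hp hs

theorem lintegral_Ioi_rpow {c t : ℝ} (hc : c < -1) (ht : 0 < t) :
    ∫⁻ s in Set.Ioi t, ENNReal.ofReal (s ^ c) = ENNReal.ofReal (-t ^ (c + 1) / (c + 1)) := by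
  rw [← integral_Ioi_rpow_of_lt hc ht, MeasureTheory.ofReal_integral_eq_lintegral_ofReal
    (integrableOn_Ioi_rpow_of_lt hc ht)]
  filter_upwards [MeasureTheory.ae_restrict_mem measurableSet_Ioi] with s hs
  exact Real.rpow_nonneg (ht.le.trans (le_of_lt hs)) _

theorem lintegral_Ioc_rpow_neg_half :
    ∫⁻ s in Set.Ioc (0 : ℝ) 1, ENNReal.ofReal (s ^ (-(1 / 2) : ℝ)) = 2 := by
  have h : ∫ s in (0 : ℝ)..1, s ^ (-(1 / 2) : ℝ) = 2 := by
    rw [integral_rpow (Or.inl (by norm_num))]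
    norm_num
  rw [intervalIntegral.integral_of_le zero_le_one] at h
  rw [← MeasureTheory.ofReal_integral_eq_lintegral_ofReal, h]
  · simp
  · rw [← MeasureTheory.IntegrableOn, ← intervalIntegrable_iff_integrableOn_Ioc_of_le zero_le_one]
    exact intervalIntegral.intervalIntegrable_rpow' (by norm_num)
  · filter_upwards [MeasureTheory.ae_restrict_mem measurableSet_Ioc] with s hs
    exact Real.rpow_nonneg hs.1.le _

theorem measurable_ofReal_rpow (c : ℝ) : Measurable fun s : ℝ => ENNReal.ofReal (s ^ c) :=
  (measurable_id.pow_const c).ennreal_ofReal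

theorem le_interpSeq (hK : MonotoneOn K (Set.Ioi 0)) {t p : ℝ} (ht : 0 < t) (hp : 1 < p) :
    K t ≤ 2 * ENNReal.ofReal (t ^ (1 - 1 / p)) * interpSeq K (1 - 1 / p) p := by
  have hp0 : 0 < p := by linarith
  have hp1 : 1 / p < 1 := by rw [div_lt_one hp0]; exact hp
  have hI : ENNReal.ofReal (t ^ (1 - p) / (p - 1)) * K t ^ p ≤
      ∫⁻ s in Set.Ioi (0 : ℝ), ENNReal.ofReal (s ^ (-p)) * K s ^ p := by
    have e : t ^ (1 - p) / (p - 1) = -t ^ (-p + 1) / (-p + 1) := by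
      rw [neg_div, ← div_neg]
      congr 2 <;> ring
    rw [e, ← lintegral_Ioi_rpow (by linarith) ht,
      ← MeasureTheory.lintegral_mul_const _ (measurable_ofReal_rpow _)]
    refine le_trans (MeasureTheory.setLIntegral_mono' measurableSet_Ioi fun s hs => ?_)
      (MeasureTheory.lintegral_mono_set (Set.Ioi_subset_Ioi ht.le))
    gcongr
    exact hK ht (ht.trans hs) (le_of_lt hs)
  -- Bernoulli's inequality: the tail integral and the normalization multiply to t^{1-p}/p, so the
  -- loss is p^{1/p} ≤ 2.
  have hpow : p ≤ 2 ^ p := by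
    have := one_add_mul_self_le_rpow_one_add (s := 1) (by norm_num) hp.le
    rw [one_add_one_eq_two] at this
    linarith
  have hreal : (1 : ℝ) ≤ (2 * t ^ (1 - 1 / p)) ^ p * ((1 - 1 / p) * (t ^ (1 - p) / (p - 1))) := by
    rw [Real.mul_rpow two_pos.le (by positivity), ← Real.rpow_mul ht.le]
    have e1 : (1 - 1 / p) * p = p - 1 := by field_simp
    have e2 : t ^ (p - 1) * t ^ (1 - p) = 1 := by
      rw [← Real.rpow_add ht]; simp
    have hp' : p - 1 ≠ 0 := by linarith
    calc (1 : ℝ) ≤ 2 ^ p / p := by rwa [le_div_iff₀ hp0, one_mul]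
      _ = 2 ^ p * (t ^ (p - 1) * t ^ (1 - p)) / p := by rw [e2, mul_one]
      _ = _ := by rw [e1]; field_simp
  have hpne : p * (1 / p) = 1 := by field_simp
  calc K t = (K t ^ p) ^ (1 / p) := by rw [← ENNReal.rpow_mul, hpne, ENNReal.rpow_one]
    _ ≤ (ENNReal.ofReal ((2 * t ^ (1 - 1 / p)) ^ p * ((1 - 1 / p) * (t ^ (1 - p) / (p - 1)))) *
        K t ^ p) ^ (1 / p) := by
        gcongr
        exact le_mul_of_one_le_left' (ENNReal.one_le_ofReal.2 hreal)
    _ = (ENNReal.ofReal (2 * t ^ (1 - 1 / p)) ^ p * (ENNReal.ofReal (1 - 1 / p) *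
        (ENNReal.ofReal (t ^ (1 - p) / (p - 1)) * K t ^ p))) ^ (1 / p) := by
        rw [ENNReal.ofReal_mul (by positivity), ENNReal.ofReal_mul (by linarith),
          ENNReal.ofReal_rpow_of_pos (by positivity), mul_assoc, mul_assoc]
    _ ≤ (ENNReal.ofReal (2 * t ^ (1 - 1 / p)) ^ p * (ENNReal.ofReal (1 - 1 / p) *
        ∫⁻ s in Set.Ioi (0 : ℝ), ENNReal.ofReal (s ^ (-p)) * K s ^ p)) ^ (1 / p) := by
        gcongr
    _ = _ := by
        rw [interpSeq_eq K hp, ENNReal.mul_rpow_of_nonneg _ _ (by positivity : 0 ≤ 1 / p),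
          ← ENNReal.rpow_mul, hpne, ENNReal.rpow_one, ENNReal.ofReal_mul two_pos.le,
          ENNReal.ofReal_ofNat]

theorem interp_integrand_le (hP : GrowthClass κ P) {A : ℝ≥0∞}
    (hA : ∀ t p : ℝ, 0 < t → 1 < p → K t ≤ A * ENNReal.ofReal (P p * t ^ (1 - 1 / p)))
    {p q s : ℝ} (hp : 1 < p) (hq : 1 < q) (hs : 0 < s) :
    ENNReal.ofReal (s ^ (-p)) * K s ^ p ≤
      ENNReal.ofReal (s ^ (-(p / q))) * (A * ENNReal.ofReal (P q)) ^ p := by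
  have hPq := hP.pos q (by linarith)
  have hp0 : 0 < p := by linarith
  calc ENNReal.ofReal (s ^ (-p)) * K s ^ p
      ≤ ENNReal.ofReal (s ^ (-p)) * (A * ENNReal.ofReal (P q * s ^ (1 - 1 / q))) ^ p := by
        gcongr
        exact hA s q hs hq
    _ = ENNReal.ofReal (s ^ (-p)) *
        ((A * ENNReal.ofReal (P q)) ^ p * ENNReal.ofReal (s ^ ((1 - 1 / q) * p))) := by
        rw [ENNReal.ofReal_mul hPq.le, ← mul_assoc, ENNReal.mul_rpow_of_nonneg _ _ hp0.le,
          ENNReal.ofReal_rpow_of_pos (by positivity), ← Real.rpow_mul hs.le]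
    _ = _ := by
        rw [mul_left_comm, ← ENNReal.ofReal_mul (by positivity), ← Real.rpow_add hs, mul_comm]
        congr 3
        ring

theorem interpSeq_le (hP : GrowthClass κ P) {A : ℝ≥0∞}
    (hA : ∀ t p : ℝ, 0 < t → 1 < p → K t ≤ A * ENNReal.ofReal (P p * t ^ (1 - 1 / p)))
    {p : ℝ} (hp : 1 < p) :
    interpSeq K (1 - 1 / p) p ≤ 4 * (A * ENNReal.ofReal (P (2 * p))) := by
  have hp0 : 0 < p := by linarith
  have hp1 : 1 / p < 1 := by rw [div_lt_one hp0]; exact hp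
  have hp2 : 0 < 1 / p := by positivity
  set B := A * ENNReal.ofReal (P (2 * p)) with hB
  have hBq : ∀ q : ℝ, 1 < q → q ≤ 2 * p → (A * ENNReal.ofReal (P q)) ^ p ≤ B ^ p := by
    intro q h1 h2
    refine ENNReal.rpow_le_rpow (mul_le_mul_right (ENNReal.ofReal_le_ofReal ?_) _) hp0.le
    exact hP.mono (Set.mem_Ici.2 (by linarith)) (Set.mem_Ici.2 (by linarith)) h2
  -- Near 0 the bound with exponent q = 2p turns the integrand into a multiple of s^{-1/2}.
  have hsmall : ∫⁻ s in Set.Ioc (0 : ℝ) 1, ENNReal.ofReal (s ^ (-p)) * K s ^ p ≤ 2 * B ^ p := by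
    rw [← lintegral_Ioc_rpow_neg_half,
      ← MeasureTheory.lintegral_mul_const _ (measurable_ofReal_rpow _)]
    refine MeasureTheory.setLIntegral_mono' measurableSet_Ioc fun s hs => ?_
    refine (interp_integrand_le hP hA hp (q := 2 * p) (by linarith) hs.1).trans (le_of_eq ?_)
    congr 4
    field_simp
  -- Near ∞ the exponent q = (1 + p)/2 < p gives integrable decay. The integral (1 + p)/(p - 1)
  -- blows up as p → 1, which the normalization 1 - 1/p compensates in `hfactor`.
  have hlarge : ∫⁻ s in Set.Ioi (1 : ℝ), ENNReal.ofReal (s ^ (-p)) * K s ^ p ≤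
      ENNReal.ofReal ((1 + p) / (p - 1)) * B ^ p := by
    have hlt : -(p / ((1 + p) / 2)) < -1 := by
      rw [neg_lt_neg_iff, lt_div_iff₀ (by linarith)]
      linarith
    have e : (1 + p) / (p - 1) =
        -(1 : ℝ) ^ (-(p / ((1 + p) / 2)) + 1) / (-(p / ((1 + p) / 2)) + 1) := by
      rw [Real.one_rpow]
      have h1 : 1 + p ≠ 0 := by linarith
      have h2 : p - 1 ≠ 0 := by linarith
      have h3 : -(p / ((1 + p) / 2)) + 1 = -((p - 1) / (1 + p)) := by
        field_simp
        ring
      rw [h3, neg_div_neg_eq, one_div_div]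
    rw [e, ← lintegral_Ioi_rpow hlt one_pos,
      ← MeasureTheory.lintegral_mul_const _ (measurable_ofReal_rpow _)]
    refine MeasureTheory.setLIntegral_mono' measurableSet_Ioi fun s hs => ?_
    refine (interp_integrand_le hP hA hp (q := (1 + p) / 2) (by linarith)
      (one_pos.trans hs)).trans ?_
    exact mul_le_mul_right (hBq _ (by linarith) (by linarith)) _
  have hsplit : ∫⁻ s in Set.Ioi (0 : ℝ), ENNReal.ofReal (s ^ (-p)) * K s ^ p ≤
      2 * B ^ p + ENNReal.ofReal ((1 + p) / (p - 1)) * B ^ p := by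
    rw [← Set.Ioc_union_Ioi_eq_Ioi zero_le_one]
    exact (MeasureTheory.lintegral_union_le _ _ _).trans (add_le_add hsmall hlarge)
  have hfactor : ENNReal.ofReal (1 - 1 / p) * ENNReal.ofReal ((1 + p) / (p - 1)) ≤ 2 := by
    rw [← ENNReal.ofReal_mul (by linarith), ← ENNReal.ofReal_ofNat]
    refine ENNReal.ofReal_le_ofReal ?_
    have h2 : p - 1 ≠ 0 := by linarith
    have : (1 - 1 / p) * ((1 + p) / (p - 1)) = 1 + 1 / p := by field_simp; ring
    linarith
  have hfactor' : ENNReal.ofReal (1 - 1 / p) ≤ 1 := by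
    rw [ENNReal.ofReal_le_one]
    linarith
  have hpne : p * (1 / p) = 1 := by field_simp
  rw [interpSeq_eq K hp]
  calc (ENNReal.ofReal (1 - 1 / p) *
        ∫⁻ s in Set.Ioi (0 : ℝ), ENNReal.ofReal (s ^ (-p)) * K s ^ p) ^ (1 / p)
      ≤ (ENNReal.ofReal (1 - 1 / p) *
        (2 * B ^ p + ENNReal.ofReal ((1 + p) / (p - 1)) * B ^ p)) ^ (1 / p) := by gcongr
    _ ≤ (4 * B ^ p) ^ (1 / p) := by
        refine ENNReal.rpow_le_rpow ?_ hp2.le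
        rw [mul_add, ← mul_assoc, ← mul_assoc]
        calc _ ≤ 1 * 2 * B ^ p + 2 * B ^ p := by gcongr
          _ = 4 * B ^ p := by ring
    _ = 4 ^ (1 / p) * B := by
        rw [ENNReal.mul_rpow_of_nonneg _ _ hp2.le, ← ENNReal.rpow_mul, hpne, ENNReal.rpow_one]
    _ ≤ 4 * B := by
        gcongr
        conv_rhs => rw [← ENNReal.rpow_one 4]
        exact ENNReal.rpow_le_rpow_of_exponent_le (by norm_num) hp1.le

theorem yudovichSup_le_deltaSup (hP : GrowthClass κ P) (hK : MonotoneOn K (Set.Ioi 0)) :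
    yudovichSup P K ≤ 2 * deltaSup P K := by
  refine yudovichSup_le hP fun t p ht hp => ?_
  have hp0 : 0 < p := by linarith
  have hp1 : 1 / p < 1 := by rw [div_lt_one hp0]; exact hp
  have hp2 : 0 < 1 / p := by positivity
  have hPp := hP.pos p hp0.le
  have hmem : 1 - 1 / p ∈ Set.Ioo (0 : ℝ) 1 := ⟨by linarith, by linarith⟩
  have hD := le_iSup₂ (f := fun (θ : ℝ) (_ : θ ∈ Set.Ioo (0 : ℝ) 1) =>
    interpSeq K θ (1 / (1 - θ)) / ENNReal.ofReal (P (1 / (1 - θ)))) (1 - 1 / p) hmem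
  have e : 1 / (1 - (1 - 1 / p)) = p := by rw [sub_sub_cancel, one_div_one_div]
  simp only [e] at hD
  rw [ENNReal.div_le_iff (by simpa using hPp) ENNReal.ofReal_ne_top] at hD
  refine (le_interpSeq hK ht hp).trans ((mul_le_mul_right hD _).trans (le_of_eq ?_))
  rw [ENNReal.ofReal_mul hPp.le, deltaSup]
  ring

theorem exists_deltaSup_le (hP : GrowthClass κ P) :
    ∃ C : ℝ≥0, ∀ K : ℝ → ℝ≥0∞, deltaSup P K ≤ C * yudovichSup P K := by
  obtain ⟨C, hC⟩ := hP.exists_dilation_bound 2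
  refine ⟨4 * C, fun K => iSup₂_le fun θ hθ => ?_⟩
  obtain ⟨p, hp⟩ : ∃ p : ℝ, p = 1 / (1 - θ) := ⟨_, rfl⟩
  have hθ1 : 0 < 1 - θ := by linarith [hθ.2]
  have hp1 : 1 < p := by
    rw [hp, lt_div_iff₀ hθ1]
    linarith [hθ.1]
  have e : θ = 1 - 1 / p := by rw [hp, one_div_one_div, sub_sub_cancel]
  have hPp := hP.pos p (by linarith)
  rw [← hp, ENNReal.div_le_iff (by simpa using hPp) ENNReal.ofReal_ne_top, e]
  refine (interpSeq_le hP (fun t q ht hq => le_yudovichSup_mul_rpow hP K ht hq) hp1).trans ?_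
  have h2 : P (2 * p) ≤ C * P p := hC p (by linarith) _ ⟨by linarith, le_rfl⟩
  calc 4 * (yudovichSup P K * ENNReal.ofReal (P (2 * p)))
      ≤ 4 * (yudovichSup P K * ENNReal.ofReal (C * P p)) := by gcongr
    _ = _ := by
      rw [ENNReal.ofReal_mul C.coe_nonneg, ENNReal.ofReal_coe_nnreal, ENNReal.coe_mul,
        ENNReal.coe_ofNat]
      ring

end Vishik

namespace Vishik

open MeasureTheory

variable {d : ℕ}

/-! ### Fourier multipliers on `L^∞` -/

/-- The transpose `ψ ↦ 𝓕 (m 𝓕⁻¹ ψ)` of the Fourier multiplier with symbol `m`. -/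
def multiplier (m : EuclideanSpace ℝ (Fin d) → ℂ) :
    𝓢(EuclideanSpace ℝ (Fin d), ℂ) →L[ℂ] 𝓢(EuclideanSpace ℝ (Fin d), ℂ) :=
  FourierTransform.fourierCLM ℂ 𝓢(EuclideanSpace ℝ (Fin d), ℂ) ∘L
    (SchwartzMap.smulLeftCLM ℂ m) ∘L
    FourierTransform.fourierInvCLM ℂ 𝓢(EuclideanSpace ℝ (Fin d), ℂ)

theorem multiplier_apply (m : EuclideanSpace ℝ (Fin d) → ℂ)
    (ψ : 𝓢(EuclideanSpace ℝ (Fin d), ℂ)) :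
    multiplier m ψ = 𝓕 (SchwartzMap.smulLeftCLM ℂ m (𝓕⁻ ψ)) := rfl

theorem multiplier_multiplier {m₁ m₂ : EuclideanSpace ℝ (Fin d) → ℂ}
    (h₁ : m₁.HasTemperateGrowth) (h₂ : m₂.HasTemperateGrowth)
    (ψ : 𝓢(EuclideanSpace ℝ (Fin d), ℂ)) :
    multiplier m₁ (multiplier m₂ ψ) = multiplier (m₁ * m₂) ψ := by
  rw [multiplier_apply, multiplier_apply m₂, FourierTransform.fourierInv_fourier_eq,
    SchwartzMap.smulLeftCLM_smulLeftCLM_apply h₁ h₂, multiplier_apply]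

theorem multiplier_zero (ψ : 𝓢(EuclideanSpace ℝ (Fin d), ℂ)) :
    multiplier (0 : EuclideanSpace ℝ (Fin d) → ℂ) ψ = 0 := by
  have h : SchwartzMap.smulLeftCLM ℂ (0 : EuclideanSpace ℝ (Fin d) → ℂ) (𝓕⁻ ψ) = 0 := by
    ext x
    have h0 : (0 : EuclideanSpace ℝ (Fin d) → ℂ).HasTemperateGrowth :=
      Function.HasTemperateGrowth.const (0 : ℂ)
    rw [SchwartzMap.smulLeftCLM_apply_apply h0]
    simp
  rw [multiplier_apply, h, FourierTransform.fourier_zero]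

theorem fourierInv_apply_eq (ψ : 𝓢(EuclideanSpace ℝ (Fin d), ℂ))
    (x : EuclideanSpace ℝ (Fin d)) : (𝓕⁻ ψ) x = (𝓕 ψ) (-x) := by
  rw [SchwartzMap.fourierInv_coe, SchwartzMap.fourier_coe, Real.fourierInv_eq_fourier_neg]

theorem fourier_multiplier_apply {m : EuclideanSpace ℝ (Fin d) → ℂ}
    (hm : m.HasTemperateGrowth) (ψ : 𝓢(EuclideanSpace ℝ (Fin d), ℂ))
    (x : EuclideanSpace ℝ (Fin d)) : 𝓕 (multiplier m ψ) x = m (-x) * 𝓕 ψ x := by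
  have h := fourierInv_apply_eq (multiplier m ψ) (-x)
  rw [neg_neg, multiplier_apply, FourierTransform.fourierInv_fourier_eq,
    SchwartzMap.smulLeftCLM_apply_apply hm, fourierInv_apply_eq, neg_neg] at h
  rw [multiplier_apply, ← h, smul_eq_mul]

/-- Both sides have the same Fourier transform, since applying 𝓕 twice to M reflects it. -/
theorem multiplier_eq_convolution (M ψ : 𝓢(EuclideanSpace ℝ (Fin d), ℂ)) :
    multiplier M ψ = SchwartzMap.convolution (ContinuousLinearMap.mul ℂ ℂ) (𝓕 M) ψ := by
  have h : 𝓕 (multiplier M ψ) =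
      𝓕 (SchwartzMap.convolution (ContinuousLinearMap.mul ℂ ℂ) (𝓕 M) ψ) := by
    rw [SchwartzMap.fourier_convolution]
    ext x
    rw [fourier_multiplier_apply M.hasTemperateGrowth, SchwartzMap.pairing_apply_apply,
      ContinuousLinearMap.mul_apply']
    congr 1
    have := fourierInv_apply_eq (𝓕 M) (-x)
    rwa [FourierTransform.fourierInv_fourier_eq, neg_neg] at this
  exact (FourierTransform.fourierCLE ℂ 𝓢(EuclideanSpace ℝ (Fin d), ℂ)).injective h

theorem multiplier_apply_eq_integral (M ψ : 𝓢(EuclideanSpace ℝ (Fin d), ℂ))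
    (x : EuclideanSpace ℝ (Fin d)) :
    multiplier M ψ x = ∫ y, (𝓕 M) (x - y) * ψ y := by
  rw [multiplier_eq_convolution, SchwartzMap.convolution_apply, convolution_eq_swap]
  rfl

/-- Young's inequality for the convolution of an `L^∞` function with an integrable kernel, in the
form of a bound for Fourier multipliers acting on tempered distributions. -/
theorem supNorm_le_of_multiplier (M : 𝓢(EuclideanSpace ℝ (Fin d), ℂ)) {C : ℝ≥0} (hC0 : C ≠ 0)
    (hC : ∫ x, ‖(𝓕 M) x‖ ≤ C) {u v : 𝓢'(EuclideanSpace ℝ (Fin d), ℂ)}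
    (h : ∀ ψ, v ψ = u (multiplier M ψ)) : supNorm v ≤ C * supNorm u := by
  -- C ≠ 0 matters here: the infimum is ∞ when u has no bounded representative, and 0 · ∞ = 0.
  rw [supNorm, supNorm, ENNReal.mul_iInf_of_ne (by simpa using hC0) ENNReal.coe_ne_top]
  refine le_iInf fun g => ?_
  rw [ENNReal.mul_iInf_of_ne (by simpa using hC0) ENNReal.coe_ne_top]
  refine le_iInf fun hg => ?_
  set k : 𝓢(EuclideanSpace ℝ (Fin d), ℂ) := 𝓕 M with hk
  -- The kernel is reflected because the multiplier acts on the test function; G represents v by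
  -- Fubini.
  set G : EuclideanSpace ℝ (Fin d) → ℂ := fun y => ∫ x, k (x - y) * g x with hG
  have hgm : AEStronglyMeasurable g volume := Lp.aestronglyMeasurable g
  have hgb : ∀ᵐ x, ‖g x‖ ≤ ‖g‖ := by
    have := ae_le_eLpNormEssSup (f := g) (μ := volume)
    filter_upwards [this] with x hx
    rw [← eLpNorm_exponent_top, ← Lp.enorm_def] at hx
    simpa [enorm_le_iff_norm_le] using hx
  have hGm : AEStronglyMeasurable G volume := by
    have h1 : AEStronglyMeasurable
        (fun z : EuclideanSpace ℝ (Fin d) × EuclideanSpace ℝ (Fin d) => k (z.2 - z.1) * g z.2)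
        (volume.prod volume) :=
      ((k.continuous.comp (by fun_prop)).aestronglyMeasurable).mul hgm.comp_snd
    exact h1.integral_prod_right'
  have hGb : ∀ y, ‖G y‖ ≤ C * ‖g‖ := by
    intro y
    have h1 : Integrable (fun x => ‖k (x - y)‖ * ‖g‖) :=
      ((k.integrable.comp_sub_right y).norm).mul_const _
    calc ‖G y‖ ≤ ∫ x, ‖k (x - y)‖ * ‖g‖ := by
          refine norm_integral_le_of_norm_le h1 ?_
          filter_upwards [hgb] with x hx
          rw [norm_mul]
          gcongr
      _ = (∫ x, ‖k x‖) * ‖g‖ := by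
          rw [integral_mul_const, integral_sub_right_eq_self (fun x => ‖k x‖) y]
      _ ≤ C * ‖g‖ := by gcongr
  have hGL : MemLp G ∞ volume := memLp_top_of_bound hGm _ (Filter.Eventually.of_forall hGb)
  refine iInf₂_le_of_le (hGL.toLp G) ?_ ?_
  · ext ψ
    rw [h, ← hg, Lp.toTemperedDistribution_apply, Lp.toTemperedDistribution_apply]
    have hint : Integrable (fun z : EuclideanSpace ℝ (Fin d) × EuclideanSpace ℝ (Fin d) =>
        k (z.1 - z.2) * ψ z.2 * g z.1) (volume.prod volume) := by
      have h1 : Integrable (fun z : EuclideanSpace ℝ (Fin d) × EuclideanSpace ℝ (Fin d) =>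
          k (z.1 - z.2) * ψ z.2) (volume.prod volume) := by
        have := ψ.integrable.convolution_integrand (μ := volume) (ν := volume)
          (ContinuousLinearMap.mul ℂ ℂ) k.integrable
        refine this.congr (Filter.Eventually.of_forall fun z => ?_)
        simp [mul_comm]
      have h2 : ∀ᵐ z : EuclideanSpace ℝ (Fin d) × EuclideanSpace ℝ (Fin d) ∂(volume.prod volume),
          ‖g z.1‖ ≤ ‖g‖ := Measure.quasiMeasurePreserving_fst.ae hgb
      exact h1.mul_bdd hgm.comp_fst h2
    calc ∫ y, ψ y • (hGL.toLp G) y = ∫ y, ∫ x, k (x - y) * ψ y * g x := by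
          refine integral_congr_ae ?_
          filter_upwards [hGL.coeFn_toLp] with y hy
          rw [hy, hG, smul_eq_mul, ← integral_const_mul]
          congr 1
          ext x
          ring
      _ = ∫ x, ∫ y, k (x - y) * ψ y * g x := (integral_integral_swap hint).symm
      _ = ∫ x, multiplier M ψ x • g x := by
          congr 1
          ext x
          rw [multiplier_apply_eq_integral, smul_eq_mul, ← integral_mul_const]
  · rw [Lp.enorm_toLp, eLpNorm_exponent_top]
    refine (eLpNormEssSup_le_of_ae_bound (Filter.Eventually.of_forall hGb)).trans ?_
    rw [ENNReal.ofReal_mul C.coe_nonneg, ENNReal.ofReal_coe_nnreal, ofReal_norm]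

/-- The amplitude factor of the dilated transform cancels the Jacobian, whence bounds uniform in the
frequency scale. -/
theorem integral_norm_fourier_comp_smul (f : EuclideanSpace ℝ (Fin d) → ℂ) {c : ℝ} (hc : c ≠ 0) :
    ∫ w, ‖𝓕 (fun x => f (c • x)) w‖ = ∫ w, ‖𝓕 f w‖ := by
  have h : ∀ w, 𝓕 (fun x => f (c • x)) w =
      |(c ^ Module.finrank ℝ (EuclideanSpace ℝ (Fin d)))⁻¹| • 𝓕 f (c⁻¹ • w) := by
    intro w
    rw [Real.fourier_eq, Real.fourier_eq, ← Measure.integral_comp_smul]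
    congr 1
    ext v
    rw [real_inner_smul_left, real_inner_smul_right, mul_inv_cancel_left₀ hc]
  simp_rw [h, norm_smul]
  rw [integral_const_mul, Measure.integral_comp_inv_smul volume (fun w => ‖𝓕 f w‖) c]
  rw [smul_eq_mul, ← mul_assoc, norm_abs_eq_norm, Real.norm_eq_abs, ← abs_mul,
    inv_mul_cancel₀ (pow_ne_zero _ hc), abs_one, one_mul]

theorem supNorm_zero : supNorm (0 : 𝓢'(EuclideanSpace ℝ (Fin d), ℂ)) = 0 := by
  refine le_antisymm (iInf₂_le_of_le 0 ?_ (by simp)) zero_le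
  rw [← Lp.toTemperedDistributionCLM_apply, map_zero]

theorem supNorm_add_le (u v : 𝓢'(EuclideanSpace ℝ (Fin d), ℂ)) :
    supNorm (u + v) ≤ supNorm u + supNorm v := by
  simp only [supNorm, ENNReal.iInf_add, ENNReal.add_iInf]
  refine le_iInf fun g' => le_iInf fun hg' => le_iInf fun g => le_iInf fun hg => ?_
  refine iInf₂_le_of_le (g + g') ?_ (enorm_add_le _ _)
  rw [← hg, ← hg', ← Lp.toTemperedDistributionCLM_apply, map_add]
  rfl

theorem supNorm_sub_le (u v : 𝓢'(EuclideanSpace ℝ (Fin d), ℂ)) :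
    supNorm (u - v) ≤ supNorm u + supNorm v := by
  simp only [supNorm, ENNReal.iInf_add, ENNReal.add_iInf]
  refine le_iInf fun g' => le_iInf fun hg' => le_iInf fun g => le_iInf fun hg => ?_
  refine iInf₂_le_of_le (g - g') ?_ enorm_sub_le
  rw [← hg, ← hg', ← Lp.toTemperedDistributionCLM_apply, map_sub]
  rfl

/-! ### Low-frequency projections -/

namespace Generator

variable (φ : Generator d)

theorem eq_zero_of_norm_le {ξ : EuclideanSpace ℝ (Fin d)} (h : ‖ξ‖ ≤ 3 / 4) : φ.toFun ξ = 0 := by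
  by_contra hne
  have := (φ.tsupport_subset (subset_tsupport _ hne)).1
  linarith

theorem eq_zero_of_le_norm {ξ : EuclideanSpace ℝ (Fin d)} (h : 7 / 4 ≤ ‖ξ‖) : φ.toFun ξ = 0 := by
  by_contra hne
  have := (φ.tsupport_subset (subset_tsupport _ hne)).2
  linarith

theorem norm_dilate (j : ℤ) (ξ : EuclideanSpace ℝ (Fin d)) :
    ‖(2 : ℝ) ^ (-j) • ξ‖ = (2 : ℝ) ^ (-j) * ‖ξ‖ := by
  rw [norm_smul, Real.norm_of_nonneg (by positivity)]

/-- In this annulus all other dyadic dilates vanish, so the resolution of unity leaves a single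
term. This makes `cutoff` locally constant across the sphere ‖ξ‖ = 1, hence smooth. -/
theorem eq_one_of_mem_Ioo {ξ : EuclideanSpace ℝ (Fin d)} (h1 : 7 / 8 < ‖ξ‖) (h2 : ‖ξ‖ < 3 / 2) :
    φ.toFun ξ = 1 := by
  have hne : ξ ≠ 0 := by
    rintro rfl
    rw [norm_zero] at h1
    linarith
  have h := φ.hasSum_one ξ hne
  have h' := hasSum_single (f := fun j : ℤ => φ.toFun ((2 : ℝ) ^ (-j) • ξ)) 0 fun j hj => by
    rcases lt_or_gt_of_ne hj with hj | hj
    · refine φ.eq_zero_of_le_norm ?_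
      have : (2 : ℝ) ^ (1 : ℤ) ≤ 2 ^ (-j) := zpow_le_zpow_right₀ one_le_two (by omega)
      rw [zpow_one] at this
      rw [norm_dilate]
      nlinarith
    · refine φ.eq_zero_of_norm_le ?_
      have : (2 : ℝ) ^ (-j) ≤ 2 ^ (-1 : ℤ) := zpow_le_zpow_right₀ one_le_two (by omega)
      rw [zpow_neg_one] at this
      rw [norm_dilate]
      nlinarith
  have := h'.unique h
  simpa using this

/-- The sum `∑_{j ≤ 0} φ(2^{-j} ξ)`, extended by `1` to the origin. -/
def cutoff (ξ : EuclideanSpace ℝ (Fin d)) : ℝ := if ‖ξ‖ ≤ 1 then 1 else φ.toFun ξ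

theorem cutoff_eq_one {ξ : EuclideanSpace ℝ (Fin d)} (h : ‖ξ‖ < 3 / 2) : φ.cutoff ξ = 1 := by
  unfold cutoff
  split_ifs with h1
  · rfl
  · exact φ.eq_one_of_mem_Ioo (by linarith) h

theorem cutoff_eq_zero {ξ : EuclideanSpace ℝ (Fin d)} (h : 7 / 4 ≤ ‖ξ‖) : φ.cutoff ξ = 0 := by
  rw [cutoff, if_neg (by linarith), φ.eq_zero_of_le_norm h]

theorem contDiff_cutoff : ContDiff ℝ ∞ φ.cutoff := by
  rw [contDiff_iff_contDiffAt]
  intro ξ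
  rcases lt_or_ge ‖ξ‖ (3 / 2) with h | h
  · have : φ.cutoff =ᶠ[nhds ξ] fun _ => 1 := by
      filter_upwards [continuous_norm.continuousAt.eventually (gt_mem_nhds h)] with x hx
      exact φ.cutoff_eq_one hx
    exact contDiffAt_const.congr_of_eventuallyEq this
  · have : φ.cutoff =ᶠ[nhds ξ] φ.toFun := by
      have h' : (1 : ℝ) < ‖ξ‖ := by linarith
      filter_upwards [continuous_norm.continuousAt.eventually (lt_mem_nhds h')] with x hx
      exact if_neg (not_le.2 hx)
    exact φ.smooth.contDiffAt.congr_of_eventuallyEq this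

/-- The symbol of the projection to frequencies below `2^N`. -/
def lowSymbol (N : ℤ) (ξ : EuclideanSpace ℝ (Fin d)) : ℂ := (φ.cutoff ((2 : ℝ) ^ (-N) • ξ) : ℂ)

theorem contDiff_lowSymbol (N : ℤ) : ContDiff ℝ ∞ (φ.lowSymbol N) :=
  Complex.ofRealCLM.contDiff.comp (φ.contDiff_cutoff.comp (contDiff_const_smul _))

theorem hasCompactSupport_lowSymbol (N : ℤ) : HasCompactSupport (φ.lowSymbol N) := by
  have hne : ((2 : ℝ) ^ (-N)) ≠ 0 := by positivity
  have hc : HasCompactSupport φ.cutoff := by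
    refine HasCompactSupport.of_support_subset_isCompact
      (isCompact_closedBall (0 : EuclideanSpace ℝ (Fin d)) (7 / 4)) fun ξ hξ => ?_
    rw [mem_closedBall_zero_iff]
    by_contra h
    exact hξ (φ.cutoff_eq_zero (not_le.1 h).le)
  exact (hc.comp_smul hne).comp_left (g := ((↑) : ℝ → ℂ)) rfl

/-- The low-frequency symbol as a Schwartz function. -/
def lowSchwartz (N : ℤ) : 𝓢(EuclideanSpace ℝ (Fin d), ℂ) :=
  (φ.hasCompactSupport_lowSymbol N).toSchwartzMap (φ.contDiff_lowSymbol N)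

theorem coe_lowSchwartz (N : ℤ) : ⇑(φ.lowSchwartz N) = φ.lowSymbol N := rfl

theorem hasTemperateGrowth_lowSymbol (N : ℤ) : (φ.lowSymbol N).HasTemperateGrowth :=
  (φ.lowSchwartz N).hasTemperateGrowth

theorem integral_norm_fourier_lowSchwartz (N : ℤ) :
    ∫ x, ‖(𝓕 (φ.lowSchwartz N)) x‖ = ∫ x, ‖(𝓕 (φ.lowSchwartz 0)) x‖ := by
  have h : φ.lowSymbol N = fun x => φ.lowSymbol 0 ((2 : ℝ) ^ (-N) • x) := by
    ext x
    simp [lowSymbol]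
  simp_rw [SchwartzMap.fourier_coe, coe_lowSchwartz]
  rw [h, integral_norm_fourier_comp_smul (φ.lowSymbol 0) (by positivity)]

/-- The symbol is 1 near the origin, so 𝓕 ψ is unchanged there and keeps its infinite-order zero. -/
theorem multiplier_lowSymbol_mem (N : ℤ) {ψ : 𝓢(EuclideanSpace ℝ (Fin d), ℂ)}
    (hψ : ψ ∈ dotSchwartz d) : multiplier (φ.lowSymbol N) ψ ∈ dotSchwartz d := by
  intro n
  have hcont : Continuous (fun x : EuclideanSpace ℝ (Fin d) => ‖(2 : ℝ) ^ (-N) • (-x)‖) := by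
    fun_prop
  have hlt : ∀ᶠ x in nhds (0 : EuclideanSpace ℝ (Fin d)), ‖(2 : ℝ) ^ (-N) • (-x)‖ < 3 / 2 :=
    hcont.continuousAt.eventually (gt_mem_nhds (by norm_num))
  have heq : ⇑(𝓕 (multiplier (φ.lowSymbol N) ψ) : 𝓢(EuclideanSpace ℝ (Fin d), ℂ)) =ᶠ[nhds 0]
      ⇑(𝓕 ψ : 𝓢(EuclideanSpace ℝ (Fin d), ℂ)) := by
    filter_upwards [hlt] with x hx
    rw [fourier_multiplier_apply (φ.hasTemperateGrowth_lowSymbol N), lowSymbol,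
      φ.cutoff_eq_one hx, Complex.ofReal_one, one_mul]
  rw [(heq.iteratedFDeriv ℝ n).eq_of_nhds]
  exact hψ n

/-- The transpose of the projection to frequencies below `2^N`. -/
def lowPass (N : ℤ) : dotSchwartz d →L[ℂ] dotSchwartz d :=
  (multiplier (φ.lowSymbol N) ∘L (dotSchwartz d).subtypeL).codRestrict (dotSchwartz d)
    fun ψ => φ.multiplier_lowSymbol_mem N ψ.2

theorem block_lowPass_apply (N j : ℤ) (f : DotDistribution d)
    (ψ : 𝓢(EuclideanSpace ℝ (Fin d), ℂ)) :
    φ.block j (f ∘L φ.lowPass N) ψ = φ.block j f (multiplier (φ.lowSymbol N) ψ) := by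
  have h : φ.lowPass N (φ.transpose j ψ) = φ.transpose j (multiplier (φ.lowSymbol N) ψ) := by
    refine Subtype.ext ?_
    change multiplier (φ.lowSymbol N) (multiplier (φ.symbol j) ψ) =
      multiplier (φ.symbol j) (multiplier (φ.lowSymbol N) ψ)
    rw [multiplier_multiplier (φ.hasTemperateGrowth_lowSymbol N) (φ.hasTemperateGrowth_symbol j),
      multiplier_multiplier (φ.hasTemperateGrowth_symbol j) (φ.hasTemperateGrowth_lowSymbol N),
      mul_comm]
  rw [block_apply, block_apply, ← h]
  rfl

theorem lowPass_transpose (N j : ℤ) (ψ : 𝓢(EuclideanSpace ℝ (Fin d), ℂ)) :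
    (φ.lowPass N (φ.transpose j ψ) : 𝓢(EuclideanSpace ℝ (Fin d), ℂ)) =
      multiplier (φ.lowSymbol N * φ.symbol j) ψ :=
  multiplier_multiplier (φ.hasTemperateGrowth_lowSymbol N) (φ.hasTemperateGrowth_symbol j) ψ

theorem block_lowPass_of_lt {N j : ℤ} (hj : j < N) (f : DotDistribution d) :
    φ.block j (f ∘L φ.lowPass N) = φ.block j f := by
  have hsymb : φ.lowSymbol N * φ.symbol j = φ.symbol j := by
    ext ξ
    rw [Pi.mul_apply]
    rcases lt_or_ge ‖(2 : ℝ) ^ (-N) • ξ‖ (3 / 2) with h | h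
    · rw [lowSymbol, φ.cutoff_eq_one h, Complex.ofReal_one, one_mul]
    · have h0 : φ.symbol j ξ = 0 := by
        rw [symbol, φ.eq_zero_of_le_norm, Complex.ofReal_zero]
        have : (2 : ℝ) ^ (1 : ℤ) * 2 ^ (-N) ≤ 2 ^ (-j) := by
          rw [← zpow_add₀ two_ne_zero]
          exact zpow_le_zpow_right₀ one_le_two (by omega)
        rw [zpow_one] at this
        rw [norm_dilate] at h ⊢
        nlinarith [norm_nonneg ξ]
      rw [h0, mul_zero]
  ext ψ
  have h : φ.lowPass N (φ.transpose j ψ) = φ.transpose j ψ :=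
    Subtype.ext (by rw [lowPass_transpose, hsymb]; rfl)
  change f (φ.lowPass N (φ.transpose j ψ)) = f (φ.transpose j ψ)
  rw [h]

theorem block_lowPass_of_gt {N j : ℤ} (hj : N + 1 < j) (f : DotDistribution d) :
    φ.block j (f ∘L φ.lowPass N) = 0 := by
  have hsymb : φ.lowSymbol N * φ.symbol j = 0 := by
    ext ξ
    rw [Pi.mul_apply, Pi.zero_apply]
    rcases lt_or_ge ‖(2 : ℝ) ^ (-N) • ξ‖ (7 / 4) with h | h
    · have h0 : φ.symbol j ξ = 0 := by
        rw [symbol, φ.eq_zero_of_norm_le, Complex.ofReal_zero]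
        have : (2 : ℝ) ^ (2 : ℤ) * 2 ^ (-j) ≤ 2 ^ (-N) := by
          rw [← zpow_add₀ two_ne_zero]
          exact zpow_le_zpow_right₀ one_le_two (by omega)
        rw [show (2 : ℝ) ^ (2 : ℤ) = 4 by norm_num] at this
        rw [norm_dilate] at h ⊢
        nlinarith [norm_nonneg ξ]
      rw [h0, mul_zero]
    · rw [lowSymbol, φ.cutoff_eq_zero h, Complex.ofReal_zero, zero_mul]
  ext ψ
  have h : φ.lowPass N (φ.transpose j ψ) = 0 :=
    Subtype.ext (by rw [lowPass_transpose, hsymb, multiplier_zero]; rfl)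
  change f (φ.lowPass N (φ.transpose j ψ)) = 0
  rw [h, map_zero]

theorem block_add (j : ℤ) (f g : DotDistribution d) :
    φ.block j (f + g) = φ.block j f + φ.block j g := rfl

theorem block_sub (j : ℤ) (f g : DotDistribution d) :
    φ.block j (f - g) = φ.block j f - φ.block j g := rfl

theorem exists_supNorm_block_lowPass_le :
    ∃ C : ℝ≥0, ∀ (N j : ℤ) (f : DotDistribution d),
      supNorm (φ.block j (f ∘L φ.lowPass N)) ≤ C * supNorm (φ.block j f) := by
  -- The summand 1 only ensures a nonzero constant, as Young's inequality is stated.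
  refine ⟨(∫ x, ‖(𝓕 (φ.lowSchwartz 0)) x‖).toNNReal + 1, fun N j f => ?_⟩
  refine supNorm_le_of_multiplier (φ.lowSchwartz N) (by positivity) ?_
    (φ.block_lowPass_apply N j f)
  rw [integral_norm_fourier_lowSchwartz]
  push_cast
  exact (Real.le_coe_toNNReal _).trans (by linarith)

end Generator

/-! ### The `K`-functional of a pair of Besov spaces -/

variable {κ : ℝ} (φ : Generator d) (β : ℝ)

theorem kFunctional_mono {V : Type*} [AddCommGroup V] (N₀ N₁ : V → ℝ≥0∞) (f : V) :
    Monotone fun t : ℝ => kFunctional N₀ N₁ t f := by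
  intro s t h
  unfold kFunctional
  exact iInf_mono fun f₀ => iInf_mono fun f₁ => iInf_mono fun _ => iInf_mono fun _ =>
    iInf_mono fun _ => by gcongr

theorem kSeq_le_kFunctional (κ t : ℝ) (f : DotDistribution d) :
    kSeq β κ t (fun j => supNorm (φ.block j f)) ≤
      kFunctional (besovNorm φ (β - κ)) (besovNorm φ β) t f := by
  refine le_iInf fun f₀ => le_iInf fun f₁ => le_iInf fun hf => le_iInf fun _ => le_iInf fun _ => ?_
  rw [besovNorm, besovNorm, ← ENNReal.tsum_mul_left, ← ENNReal.tsum_add, kSeq]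
  refine ENNReal.tsum_le_tsum fun j => ?_
  rw [hf, φ.block_add, ← mul_assoc]
  refine (mul_le_mul_right (supNorm_add_le _ _) _).trans ?_
  rw [mul_add]
  gcongr
  · exact min_le_left _ _
  · exact min_le_right _ _

theorem exists_dyadic_scale (hκ : 0 < κ) (τ : ℝ) :
    ∃ N : ℤ, -((N + 1) * κ) ≤ τ ∧ τ ≤ -(N * κ) := by
  refine ⟨⌊-τ / κ⌋, ?_, ?_⟩
  · have h := Int.lt_floor_add_one (-τ / κ)
    rw [div_lt_iff₀ hκ] at h
    linarith
  · have h := Int.floor_le (-τ / κ)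
    rw [le_div_iff₀ hκ] at h
    linarith

/-- With 2^{-(N+1)κ} ≤ t ≤ 2^{-Nκ}, the high part has only blocks j ≥ N and the low part only j ≤ N
+ 1. On each range the relevant weight is at most 2^κ times the minimum. -/
theorem exists_kFunctional_le (hκ : 0 < κ) :
    ∃ C : ℝ≥0, ∀ t : ℝ, 0 < t → ∀ f : DotDistribution d,
      kFunctional (besovNorm φ (β - κ)) (besovNorm φ β) t f ≤
        C * kSeq β κ t (fun j => supNorm (φ.block j f)) := by
  obtain ⟨C, hC⟩ := φ.exists_supNorm_block_lowPass_le
  refine ⟨2 ^ κ * (1 + C) + 2 ^ κ * C, fun t ht f => ?_⟩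
  obtain ⟨τ, rfl⟩ := exists_eq_two_rpow ht
  obtain ⟨N, hN1, hN2⟩ := exists_dyadic_scale hκ τ
  set a : ℤ → ℝ≥0∞ := fun j => supNorm (φ.block j f) with ha
  set w : ℤ → ℝ≥0∞ := fun j => min ((2 : ℝ≥0∞) ^ ((j : ℝ) * (β - κ)))
    (ENNReal.ofReal (2 ^ τ) * 2 ^ ((j : ℝ) * β)) with hw
  have hwj : ∀ j, w j = min ((2 : ℝ≥0∞) ^ ((j : ℝ) * (β - κ))) (2 ^ (τ + j * β)) := by
    intro j
    rw [hw, ofReal_two_rpow, two_rpow_add]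
  have hS : kSeq β κ (2 ^ τ) a = ∑' j, w j * a j := rfl
  have hcoe : ((2 ^ κ : ℝ≥0) : ℝ≥0∞) = 2 ^ κ := by
    rw [ENNReal.coe_rpow_of_ne_zero two_ne_zero, ENNReal.coe_ofNat]
  have hmulmin : ∀ j, (2 : ℝ≥0∞) ^ κ * w j =
      min ((2 : ℝ≥0∞) ^ (κ + j * (β - κ))) (2 ^ (κ + (τ + j * β))) := by
    intro j
    rw [hwj, ← min_mul_mul_left, ← two_rpow_add, ← two_rpow_add]
  set f₁ : DotDistribution d := f ∘L φ.lowPass N with hf₁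
  have h0 : besovNorm φ (β - κ) (f - f₁) ≤ 2 ^ κ * (1 + C) * kSeq β κ (2 ^ τ) a := by
    rw [hS, ← ENNReal.tsum_mul_left]
    refine ENNReal.tsum_le_tsum fun j => ?_
    rw [φ.block_sub]
    rcases lt_or_ge j N with hj | hj
    · rw [hf₁, φ.block_lowPass_of_lt hj, sub_self, supNorm_zero, mul_zero]
      exact zero_le
    · have hj' : (N : ℝ) ≤ j := by exact_mod_cast hj
      have h1 : (2 : ℝ≥0∞) ^ ((j : ℝ) * (β - κ)) ≤ 2 ^ κ * w j := by
        rw [hmulmin]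
        exact le_min (two_rpow_le (by linarith)) (two_rpow_le (by nlinarith))
      have h2 : supNorm (φ.block j f - φ.block j f₁) ≤ (1 + C) * a j := by
        refine (supNorm_sub_le _ _).trans ?_
        rw [add_mul, one_mul]
        gcongr
        exact hC N j f
      calc _ ≤ 2 ^ κ * w j * ((1 + C) * a j) := mul_le_mul' h1 h2
        _ = _ := by ring
  have h1 : ENNReal.ofReal (2 ^ τ) * besovNorm φ β f₁ ≤ 2 ^ κ * C * kSeq β κ (2 ^ τ) a := by
    rw [hS, besovNorm, ← ENNReal.tsum_mul_left, ← ENNReal.tsum_mul_left]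
    refine ENNReal.tsum_le_tsum fun j => ?_
    rcases lt_or_ge (N + 1) j with hj | hj
    · rw [hf₁, φ.block_lowPass_of_gt hj, supNorm_zero, mul_zero, mul_zero]
      exact zero_le
    · have hj' : (j : ℝ) ≤ N + 1 := by exact_mod_cast hj
      have h1 : (2 : ℝ≥0∞) ^ (τ + (j : ℝ) * β) ≤ 2 ^ κ * w j := by
        rw [hmulmin]
        exact le_min (two_rpow_le (by nlinarith)) (two_rpow_le (by linarith))
      calc ENNReal.ofReal (2 ^ τ) * (2 ^ ((j : ℝ) * β) * supNorm (φ.block j f₁))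
          = 2 ^ (τ + (j : ℝ) * β) * supNorm (φ.block j f₁) := by
            rw [ofReal_two_rpow, two_rpow_add, mul_assoc]
        _ ≤ 2 ^ κ * w j * (C * a j) := mul_le_mul' h1 (hC N j f)
        _ = _ := by ring
  rw [ENNReal.coe_add, ENNReal.coe_mul, ENNReal.coe_mul, ENNReal.coe_add, ENNReal.coe_one, hcoe]
  -- A decomposition is admissible only if both pieces have finite norm, which follows from
  -- finiteness of the sequence quantity; otherwise the right side is ∞.
  rcases eq_or_ne (kSeq β κ (2 ^ τ) a) ⊤ with htop | htop
  · rw [htop, ENNReal.mul_top]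
    · exact le_top
    · have : (2 : ℝ≥0∞) ^ κ * (1 + C) ≠ 0 := mul_ne_zero (two_rpow_ne_zero κ) (by simp)
      exact fun h => this (add_eq_zero.1 h).1
  · have hfin0 : besovNorm φ (β - κ) (f - f₁) < ⊤ :=
      h0.trans_lt (ENNReal.mul_lt_top (ENNReal.mul_lt_top (two_rpow_ne_top κ).lt_top
        (by finiteness)) htop.lt_top)
    have hfin1 : besovNorm φ β f₁ < ⊤ := by
      have h2 : ENNReal.ofReal (2 ^ τ) * besovNorm φ β f₁ < ⊤ :=
        h1.trans_lt (ENNReal.mul_lt_top (ENNReal.mul_lt_top (two_rpow_ne_top κ).lt_top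
          (by finiteness)) htop.lt_top)
      refine lt_top_iff_ne_top.2 fun h => h2.ne ?_
      rw [h, ENNReal.mul_top (by simpa using ht)]
    rw [add_mul]
    refine le_trans ?_ (add_le_add h0 h1)
    exact iInf_le_of_le (f - f₁) (iInf_le_of_le f₁ (iInf_le_of_le (sub_add_cancel f f₁).symm
      (iInf_le_of_le hfin0 (iInf_le_of_le hfin1 le_rfl))))

end Vishik

namespace Vishik

/-! ### Comparison of the four quantities -/

/-- `A` is bounded by a constant multiple of `B`. -/
def Dominated {V : Type*} (A B : V → ℝ≥0∞) : Prop := ∃ C : ℝ≥0, ∀ f, A f ≤ C * B f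

theorem Dominated.trans {V : Type*} {A B D : V → ℝ≥0∞} (h₁ : Dominated A B)
    (h₂ : Dominated B D) : Dominated A D := by
  obtain ⟨C₁, h₁⟩ := h₁
  obtain ⟨C₂, h₂⟩ := h₂
  refine ⟨C₁ * C₂, fun f => ?_⟩
  rw [ENNReal.coe_mul, mul_assoc]
  exact (h₁ f).trans (mul_le_mul_right (h₂ f) _)

theorem Dominated.equivalent {V : Type*} {A B : V → ℝ≥0∞} (h₁ : Dominated A B)
    (h₂ : Dominated B A) : Equivalent A B := by
  obtain ⟨C₁, h₁⟩ := h₁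
  obtain ⟨C₂, h₂⟩ := h₂
  refine ⟨max C₁ C₂, fun f => ⟨(h₁ f).trans ?_, (h₂ f).trans ?_⟩⟩
  · gcongr
    exact le_max_left _ _
  · gcongr
    exact le_max_right _ _

theorem yudovichSup_le_mul {P : ℝ → ℝ} {K K' : ℝ → ℝ≥0∞} {C : ℝ≥0∞}
    (h : ∀ t, 0 < t → K t ≤ C * K' t) : yudovichSup P K ≤ C * yudovichSup P K' := by
  refine iSup₂_le fun t ht => ?_
  refine (ENNReal.div_le_div_right (h t ht) _).trans ?_
  rw [mul_div_assoc]
  exact mul_le_mul_right (le_iSup₂ (f := fun (t : ℝ) (_ : t ∈ Set.Ioi (0 : ℝ)) =>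
    K' t / ENNReal.ofReal (t * yudovich P (1 / t))) t ht) _

end Vishik

end

theorem theorem3p1 (d : ℕ) (φ : Vishik.Generator d) (κ : ℝ) (hκ : 0 < κ) (β : ℝ)
    (P : ℝ → ℝ) (hP : Vishik.GrowthClass κ P) :
    Vishik.Equivalent
      (fun f : Vishik.DotDistribution d =>
        max (Vishik.vishikNorm φ P β f) (Vishik.besovNorm φ (β - κ) f))
      (fun f => ⨆ t ∈ Set.Ioi (0 : ℝ),
        Vishik.kFunctional (Vishik.besovNorm φ (β - κ)) (Vishik.besovNorm φ β) t f /
          ENNReal.ofReal (t * Vishik.yudovich P (1 / t))) ∧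
    Vishik.Equivalent
      (fun f : Vishik.DotDistribution d => ⨆ t ∈ Set.Ioi (0 : ℝ),
        Vishik.kFunctional (Vishik.besovNorm φ (β - κ)) (Vishik.besovNorm φ β) t f /
          ENNReal.ofReal (t * Vishik.yudovich P (1 / t)))
      (Vishik.deltaNorm (Vishik.besovNorm φ (β - κ)) (Vishik.besovNorm φ β)
        (fun θ => 1 / (1 - θ)) P) ∧
    Vishik.Equivalent
      (Vishik.deltaNorm (Vishik.besovNorm φ (β - κ)) (Vishik.besovNorm φ β)
        (fun θ => 1 / (1 - θ)) P)
      (fun f : Vishik.DotDistribution d => ⨆ α ∈ Set.Ioo (β - κ) β,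
        Vishik.besovNorm φ α f / ENNReal.ofReal (P (1 / (β - α)))) := by
  open Vishik in
  -- The Besov and Vishik norms of f are by definition the sequence norms of `a f`.
  let a : DotDistribution d → ℤ → ℝ≥0∞ := fun f j => supNorm (φ.block j f)
  let K : DotDistribution d → ℝ → ℝ≥0∞ := fun f t =>
    kFunctional (besovNorm φ (β - κ)) (besovNorm φ β) t f
  let Q : DotDistribution d → ℝ≥0∞ := fun f => yudovichSup P fun t => kSeq β κ t (a f)
  have hVQ : Dominated (fun f => max (vishikNorm φ P β f) (besovNorm φ (β - κ) f)) Q := by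
    obtain ⟨C₁, h₁⟩ := vishikSeq_le_yudovichSup hκ β hP
    obtain ⟨C₂, h₂⟩ := besovSeq_le_yudovichSup hκ β hP
    refine ⟨max C₁ C₂, fun f => max_le ((h₁ (a f)).trans ?_) ((h₂ (a f)).trans ?_)⟩
    · gcongr
      exact le_max_left _ _
    · gcongr
      exact le_max_right _ _
  have hQK : Dominated Q fun f => yudovichSup P (K f) :=
    ⟨1, fun f => yudovichSup_le_mul fun t _ => by
      rw [ENNReal.coe_one, one_mul]
      exact kSeq_le_kFunctional φ β κ t f⟩
  have hKQ : Dominated (fun f => yudovichSup P (K f)) Q := by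
    obtain ⟨C, hC⟩ := exists_kFunctional_le φ β hκ
    exact ⟨C, fun f => yudovichSup_le_mul fun t ht => hC t ht f⟩
  have hQB : Dominated Q fun f => besovSup P β κ (a f) := by
    obtain ⟨C, hC⟩ := exists_yudovichSup_kSeq_le hκ β hP
    exact ⟨C, fun f => hC (a f)⟩
  have hBV : Dominated (fun f => besovSup P β κ (a f))
      fun f => max (vishikNorm φ P β f) (besovNorm φ (β - κ) f) := by
    obtain ⟨C, hC⟩ := exists_besovSup_le hκ β hP
    exact ⟨C, fun f => hC (a f)⟩
  have hKD : Dominated (fun f => yudovichSup P (K f)) fun f => deltaSup P (K f) :=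
    ⟨2, fun f => yudovichSup_le_deltaSup hP ((kFunctional_mono _ _ f).monotoneOn _)⟩
  have hDK : Dominated (fun f => deltaSup P (K f)) fun f => yudovichSup P (K f) := by
    obtain ⟨C, hC⟩ := exists_deltaSup_le hP
    exact ⟨C, fun f => hC (K f)⟩
  -- The cycle maximum ≲ `Q` ≲ Besov supremum ≲ maximum is joined to the two-sided comparisons of
  -- `Q` with the K-quantity and of the latter with the extrapolation norm.
  exact ⟨(hVQ.trans hQK).equivalent (hKQ.trans (hQB.trans hBV)), hKD.equivalent hDK,
    (hDK.trans (hKQ.trans hQB)).equivalent (hBV.trans (hVQ.trans (hQK.trans hKD)))⟩
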